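/- All groups are abelian. For a group $A$ let $T(A)$ be its torsion subgroup, $T_p(A)$ its $p$-component, and for a positive integer $n$ let $T_n(A)=\bigoplus_{p\mid n,\ p\text{ prime}}T_p(A)$. A group of finite torsion-free rank is quotient-divisible if its torsion subgroup is reduced and it has a free subgroup $F$ such that $A/F$ is torsion and divisible. A group $A$ is self-small if for every index set $I$ the natural homomorphism $\mathrm{Hom}(A,A)^{(I)}\to\mathrm{Hom}(A,A^{(I)})$ is an isomorphism. An epimorphism $\alpha:H\to L$ is rigid if for all automorphisms $\psi$ of $H$ and $\phi$ of $L$ with $\alpha\psi=\phi\alpha$ one has $\phi=\pm 1_L$. A group $G$ has the cancellation property if $G\oplus H\cong G\oplus K$ implies $H\cong K$ for all groups $H,K$. A ring $R$ has the unit lifting property if for every positive integer $n$ every unit of $R/nR$ is the image of a unit of $R$. Put $\mathrm{End}_{\mathrm W}(G)=\mathrm{End}(G)/\mathrm{Hom}(G,T(G))$. **Proposition.** Let $G$ be a reduced quotient-divisible group without nonzero free direct summands. (1) $G$ is self-small of finite torsion-free rank. For every positive integer $n$ the subgroup $T_n(G)$ is a direct summand of $G$, and for every decomposition $G=T_n(G)\oplus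 G(n)$ there is a torsion-free group $H$ such that (I) there is a rigid epimorphism $H\to G(n)/nG(n)$, (II) $\mathrm{Hom}(G,H)=0$, (III) $\mathrm{Hom}(H,G)$ is a torsion group. Moreover, $H$ can be chosen as a finite direct sum $\bigoplus_i W_i$ of torsion-free groups with $\mathrm{End}(W_i)\cong\mathbb Z$ (as rings) for all $i$ and $\mathrm{Hom}(W_i,W_j)=0$ for all $i\neq j$. (2) If $G$ has the cancellation property, then $\mathrm{End}_{\mathrm W}(G)$ has the unit lifting property. -/

import Mathlib

universe u

namespace MixedGroup

/-- An abelian group is divisible if multiplication by every positive integer is onto. -/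
def IsDivisible (A : Type u) [AddCommGroup A] : Prop :=
  ∀ n : ℕ, 0 < n → ∀ x : A, ∃ y : A, n • y = x

/-- An abelian group is reduced if its only divisible subgroup is zero. -/
def IsReducedGroup (A : Type u) [AddCommGroup A] : Prop :=
  ∀ D : AddSubgroup A, IsDivisible D → D = ⊥

/-- Finite torsion-free rank: the maximal number of `ℤ`-independent elements is finite. -/
def FiniteTorsionFreeRank (A : Type u) [AddCommGroup A] : Prop :=
  Module.rank ℤ A < Cardinal.aleph0

/-- A group of finite torsion-free rank is quotient-divisible if its torsion part is reduced and
it has a full free subgroup `F` (full: the quotient by `F` is torsion) with divisible quotient. -/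
structure IsQuotientDivisible (A : Type u) [AddCommGroup A] : Prop where
  finite_rank : FiniteTorsionFreeRank A
  torsion_reduced : IsReducedGroup (AddCommGroup.torsion A)
  exists_full_free : ∃ F : AddSubgroup A,
    Module.Free ℤ F ∧ IsAddTorsion (A ⧸ F) ∧ IsDivisible (A ⧸ F)

/-- No nonzero direct summand of `A` is a free abelian group. -/
def NoFreeSummand (A : Type u) [AddCommGroup A] : Prop :=
  ∀ B C : AddSubgroup A, IsCompl B C → Module.Free ℤ B → B = ⊥

/-- The natural homomorphism `Hom(A, A)^(I) → Hom(A, A^(I))`. -/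
noncomputable def selfSmallMap (A : Type u) [AddCommGroup A] (I : Type u) :
    (I →₀ (A →+ A)) →+ (A →+ (I →₀ A)) :=
  Finsupp.liftAddHom fun i => AddMonoidHom.compHom (Finsupp.singleAddHom i)

/-- `A` is self-small: the natural map `Hom(A, A)^(I) → Hom(A, A^(I))` is an isomorphism for
every index set `I`. -/
def IsSelfSmall (A : Type u) [AddCommGroup A] : Prop :=
  ∀ I : Type u, Function.Bijective (selfSmallMap A I)

/-- The `p`-component `T_p(A)`: the elements whose order is a power of `p`. -/
def pComponent (A : Type u) [AddCommGroup A] (p : ℕ) : AddSubgroup A where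
  carrier := {x | ∃ k : ℕ, p ^ k • x = 0}
  zero_mem' := ⟨0, by simp⟩
  neg_mem' := by
    rintro x ⟨k, hk⟩
    exact ⟨k, by simp [hk]⟩
  add_mem' := by
    rintro x y ⟨k, hk⟩ ⟨l, hl⟩
    refine ⟨k + l, ?_⟩
    have h1 : p ^ (k + l) • x = 0 := by rw [pow_add, mul_comm, mul_smul, hk, smul_zero]
    have h2 : p ^ (k + l) • y = 0 := by rw [pow_add, mul_smul, hl, smul_zero]
    rw [smul_add, h1, h2, add_zero]

/-- `T_n(A)`: the (automatically direct) sum of the `p`-components with `p` a prime divisor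
of `n`. -/
def nComponent (A : Type u) [AddCommGroup A] (n : ℕ) : AddSubgroup A :=
  ⨆ p ∈ n.primeFactors, pComponent A p

/-- The subgroup `nA` of `A`. -/
def nMul (A : Type u) [AddCommGroup A] (n : ℕ) : AddSubgroup A :=
  (nsmulAddMonoidHom n : A →+ A).range

/-- A rigid epimorphism `α : H → L`: whenever `α ψ = φ α` with automorphisms `ψ` of `H` and `φ`
of `L`, then `φ` is the identity or minus the identity. -/
def IsRigidEpi {H L : Type u} [AddCommGroup H] [AddCommGroup L] (α : H →+ L) : Prop :=
  Function.Surjective α ∧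
    ∀ (ψ : H ≃+ H) (φ : L ≃+ L), (∀ h, α (ψ h) = φ (α h)) →
      (∀ x, φ x = x) ∨ (∀ x, φ x = -x)

/-- For a complement `C` of `T_n(G)` in `G`: the group `H` is torsion-free,
there is a rigid epimorphism from `H` onto `C / nC`, `Hom(G, H) = 0` and `Hom(H, G)` is torsion. -/
structure IsFuchsWitness (G : Type u) [AddCommGroup G] (n : ℕ) (C : AddSubgroup G)
    (H : Type u) [AddCommGroup H] : Prop where
  torsionFree : IsAddTorsionFree H
  exists_rigid : ∃ α : H →+ C ⧸ nMul C n, IsRigidEpi α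
  hom_zero : ∀ f : G →+ H, f = 0
  hom_torsion : IsAddTorsion (H →+ G)

/-- `H` is a finite direct sum of torsion-free groups with endomorphism ring `ℤ` and no nonzero
homomorphisms between distinct summands. -/
def IsOrthogonalRigidSum (H : Type u) [AddCommGroup H] : Prop :=
  ∃ (ι : Type) (_ : Finite ι) (W : ι → Type u) (_ : ∀ i, AddCommGroup (W i)),
    (∀ i, IsAddTorsionFree (W i)) ∧
    (∀ i, Nonempty (AddMonoid.End (W i) ≃+* ℤ)) ∧
    (∀ i j, i ≠ j → ∀ f : W i →+ W j, f = 0) ∧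
    Nonempty (H ≃+ DirectSum ι W)

/-- The cancellation property. -/
def HasCancellation (G : Type u) [AddCommGroup G] : Prop :=
  ∀ (H K : Type u) [AddCommGroup H] [AddCommGroup K],
    Nonempty ((G × H) ≃+ (G × K)) → Nonempty (H ≃+ K)

/-- `Hom(G, T(G))` as an ideal of `End(G)`. -/
def homTorsion (G : Type u) [AddCommGroup G] : Ideal (AddMonoid.End G) where
  carrier := {f | ∀ x, f x ∈ AddCommGroup.torsion G}
  zero_mem' := fun _ => zero_mem _
  add_mem' := fun hf hg x => add_mem (hf x) (hg x)
  smul_mem' := fun c _ hf x => AddMonoidHom.isOfFinAddOrder c (hf x)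

instance homTorsion_isTwoSided (G : Type u) [AddCommGroup G] : (homTorsion G).IsTwoSided :=
  ⟨fun b hf x => hf (b x)⟩

/-- The Walk-endomorphism ring `End(G) / Hom(G, T(G))`. -/
abbrev WalkEnd (G : Type u) [AddCommGroup G] : Type u :=
  AddMonoid.End G ⧸ homTorsion G

/-- The ideal `nR` of a (not necessarily commutative) ring `R`. -/
def natIdeal (R : Type u) [Ring R] (n : ℕ) : Ideal R := Ideal.span {(n : R)}

instance natIdeal_isTwoSided (R : Type u) [Ring R] (n : ℕ) : (natIdeal R n).IsTwoSided := by
  refine ⟨fun {a} b ha => ?_⟩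
  obtain ⟨c, rfl⟩ := Ideal.mem_span_singleton'.1 ha
  exact Ideal.mem_span_singleton'.2 ⟨c * b, by rw [mul_assoc, mul_assoc, (Nat.cast_commute n b).eq]⟩

/-- The unit lifting property: for every positive integer `n`, every unit of `R / nR` is the
image of a unit of `R`. -/
def HasUnitLifting (R : Type u) [Ring R] : Prop :=
  ∀ n : ℕ, 0 < n → ∀ v : (R ⧸ natIdeal R n)ˣ,
    ∃ w : Rˣ, Ideal.Quotient.mk (natIdeal R n) (w : R) = (v : R ⧸ natIdeal R n)

end MixedGroup

/-! A full free subgroup F of G is finitely generated, and G = F + nG for all n > 0, so G/nG is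
finite. Reducedness then makes the n-primary part finite; a finite n-primary part is pure and
bounded, hence a summand. It also forces the intersection of all nG to vanish, and any map from G to
a reduced group that kills F is zero, which gives self-smallness. Without free summands, Hom(G, ℤ) =
0. What remains is recorded in `IsTame`.

The groups W are of rank two: for a profinite integer a, take the rational pairs (x, y) with y - ax
integral at every prime. A map into or out of such a group imposes an arithmetic condition on a. An
endomorphism with rational matrix entries makes a the root of a quadratic over ℤ, so for generic a
only integer scalars survive (`IsGeneric.scalar`). For tame A, each nonzero map from A, and each map
to A of infinite order, is excluded by one of countably many conditions that can be met by refining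
any residue class (`exists_conditions`). A Baire category argument meets them all. Generic limits
are again tame, so the construction iterates to an orthogonal family.

For finite L, let H be the sum of one W per element of L, with a marked vector sent to that element
(`exists_rigid_epi`). Automorphisms of H are diagonal with entries ±1, so an induced automorphism of
L sends each l to l or -l, hence is ±1.

For unit lifting, a unit modulo n gives an endomorphism a of the complement C of the n-component
that is invertible modulo nC. The pullbacks of H → C/nC along the projection C → C/nC and along a
followed by it become isomorphic after adding C (`nonempty_prod_pullback_equiv`), hence after adding
G, so cancellation makes them isomorphic. Rigidity then shows that a is congruent modulo nC to an
automorphism of C (`exists_equiv_of_pullback_equiv`), which extends to G by the identity on the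
n-component. -/

namespace MixedGroup

/-! ### Finiteness of primary parts, the ℤ-adic topology, and extension of characters -/

section Basics

variable {A : Type u} [AddCommGroup A]

/-- A quotient-divisible group has a finitely generated full subgroup `F` with `A = F + nA` for
all positive `n`. -/
theorem IsQuotientDivisible.exists_fg (h : IsQuotientDivisible A) :
    ∃ F : AddSubgroup A, F.FG ∧ (∀ x : A, ∃ m : ℕ, 0 < m ∧ m • x ∈ F) ∧
      ∀ n : ℕ, 0 < n → ∀ x : A, ∃ f ∈ F, ∃ y : A, x = f + n • y := by
  obtain ⟨F, hfree, htors, hdiv⟩ := h.exists_full_free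
  refine ⟨F, ?_, fun x => ?_, fun n hn x => ?_⟩
  · have hle : Module.rank ℤ F ≤ Module.rank ℤ A :=
      LinearMap.rank_le_of_injective F.subtype.toIntLinearMap Subtype.val_injective
    have : Module.Finite ℤ F := Module.rank_lt_aleph0_iff.1 (hle.trans_lt h.finite_rank)
    have h2 : AddGroup.FG F := Module.Finite.iff_addGroup_fg.1 this
    exact (AddGroup.fg_iff_addSubgroup_fg F).1 h2
  · obtain ⟨m, hm, hmx⟩ := (isOfFinAddOrder_iff_nsmul_eq_zero).1 (htors (x : A ⧸ F))
    refine ⟨m, hm, ?_⟩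
    rwa [← QuotientAddGroup.mk_nsmul, QuotientAddGroup.eq_zero_iff] at hmx
  · obtain ⟨y, hy⟩ := hdiv n hn (x : A ⧸ F)
    obtain ⟨y, rfl⟩ := QuotientAddGroup.mk_surjective y
    rw [← QuotientAddGroup.mk_nsmul, QuotientAddGroup.eq] at hy
    exact ⟨-(n • y) + x, hy, y, by abel⟩

theorem finite_of_fg_of_torsion {B : AddSubgroup A} (hB : B.FG)
    (h : ∀ x ∈ B, ∃ m : ℕ, 0 < m ∧ m • x = 0) : Finite B := by
  have : AddGroup.FG B := (AddGroup.fg_iff_addSubgroup_fg B).2 hB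
  exact AddCommGroup.finite_of_fg_isAddTorsion B fun x => by
    obtain ⟨m, hm, hx⟩ := h x x.2
    exact isOfFinAddOrder_iff_nsmul_eq_zero.2 ⟨m, hm, Subtype.ext (by simpa using hx)⟩

theorem mem_nMul {n : ℕ} {x : A} : x ∈ nMul A n ↔ ∃ y, n • y = x := Iff.rfl

theorem finite_quotient_nMul {F : AddSubgroup A} (hF : F.FG) {n : ℕ} (hn : 0 < n)
    (hdiv : ∀ x : A, ∃ f ∈ F, ∃ y : A, x = f + n • y) : Finite (A ⧸ nMul A n) := by
  have hsurj : Function.Surjective ((QuotientAddGroup.mk' (nMul A n)).comp F.subtype) := by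
    intro q
    obtain ⟨x, rfl⟩ := QuotientAddGroup.mk_surjective q
    obtain ⟨f, hf, y, rfl⟩ := hdiv x
    exact ⟨⟨f, hf⟩, QuotientAddGroup.eq.2 ⟨y, by simp⟩⟩
  have : AddGroup.FG F := (AddGroup.fg_iff_addSubgroup_fg F).2 hF
  have : AddGroup.FG (A ⧸ nMul A n) := AddGroup.fg_of_surjective hsurj
  refine AddCommGroup.finite_of_fg_isAddTorsion _ fun q => ?_
  obtain ⟨x, rfl⟩ := QuotientAddGroup.mk_surjective q
  refine isOfFinAddOrder_iff_nsmul_eq_zero.2 ⟨n, hn, ?_⟩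
  rw [← QuotientAddGroup.mk_nsmul, QuotientAddGroup.eq_zero_iff]
  exact ⟨x, rfl⟩

theorem mem_pComponent_of_nsmul {n : ℕ} {x : A} (h : n • x ∈ pComponent A n) :
    x ∈ pComponent A n := by
  obtain ⟨k, hk⟩ := h
  exact ⟨k + 1, by rw [pow_succ, mul_smul, hk]⟩

/-- Bézout inverts factors coprime to n on an n-primary element. A common factor g of m and n is
removed by dividing by n and multiplying by n/g, which leaves the smaller factor m/g. -/
theorem exists_nsmul_eq_of_primary {D : AddSubgroup A} {n : ℕ}
    (hD : ∀ x ∈ D, ∃ y ∈ D, n • y = x) (hp : ∀ x ∈ D, ∃ k : ℕ, n ^ k • x = 0) (m : ℕ) :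
    0 < m → ∀ x ∈ D, ∃ y ∈ D, m • y = x := by
  induction m using Nat.strong_induction_on with
  | _ m ih =>
    intro hm x hx
    by_cases hc : m.gcd n = 1
    · obtain ⟨k, hk⟩ := hp x hx
      have hcop : IsCoprime (m : ℤ) ((n ^ k : ℕ) : ℤ) :=
        Nat.isCoprime_iff_coprime.2 (Nat.Coprime.pow_right k hc)
      obtain ⟨a, b, hab⟩ := hcop
      refine ⟨a • x, D.zsmul_mem hx a, ?_⟩
      have h1 : (a * m + b * ((n ^ k : ℕ) : ℤ)) • x = x := by rw [hab, one_smul]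
      rw [add_smul, mul_smul, mul_smul, natCast_zsmul, natCast_zsmul, hk, smul_zero,
        add_zero] at h1
      rw [smul_comm, h1]
    · obtain ⟨c, hc1⟩ := Nat.gcd_dvd_left m n
      obtain ⟨d, hd⟩ := Nat.gcd_dvd_right m n
      have hg0 : 0 < m.gcd n := Nat.gcd_pos_of_pos_left n hm
      have hg : 1 < m.gcd n := by omega
      have hc0 : 0 < c := Nat.pos_of_ne_zero (by rintro rfl; omega)
      have hlt : c < m := by
        calc c < m.gcd n * c := by nlinarith
          _ = m := hc1.symm
      obtain ⟨y, hy, rfl⟩ := hD x hx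
      obtain ⟨z, hz, hzy⟩ := ih c hlt hc0 (d • y) (D.nsmul_mem hy d)
      refine ⟨z, hz, ?_⟩
      rw [hc1, mul_smul, hzy, ← mul_smul, ← hd]

/-- In a reduced group with `A / nA` finite, the `n`-primary part is finite. -/
theorem finite_pComponent (hred : IsReducedGroup A) {n : ℕ} (hn : 0 < n)
    (hfin : Finite (A ⧸ nMul A n)) : Finite (pComponent A n) := by
  classical
  let T := pComponent A n
  let q : T → A ⧸ nMul A n := fun t => QuotientAddGroup.mk (t : A)
  let r : Set.range q → T := fun c => c.2.choose
  have hr : ∀ c, q (r c) = c := fun c => c.2.choose_spec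
  -- Generated by one representative for each class of T in the finite quotient A/nA, so that T = B
  -- + nT.
  let B : AddSubgroup A := AddSubgroup.closure (Set.range fun c => (r c : A))
  have hBT : B ≤ T := by
    rw [AddSubgroup.closure_le]
    rintro _ ⟨c, rfl⟩
    exact (r c).2
  have hBfg : B.FG := by
    rw [AddSubgroup.fg_iff]
    exact ⟨_, rfl, Set.finite_range _⟩
  have hpow : ∀ x ∈ T, ∃ m : ℕ, 0 < m ∧ m • x = 0 := fun x ⟨k, hk⟩ =>
    ⟨n ^ k, pow_pos hn k, hk⟩
  have hBfin : Finite B := finite_of_fg_of_torsion hBfg fun x hx => hpow x (hBT hx)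
  have hsum : ∀ t ∈ T, ∃ b ∈ B, ∃ s ∈ T, t = b + n • s := by
    intro t ht
    have h1 := hr ⟨q ⟨t, ht⟩, ⟨t, ht⟩, rfl⟩
    set b := r ⟨q ⟨t, ht⟩, ⟨t, ht⟩, rfl⟩
    obtain ⟨s, hs⟩ := QuotientAddGroup.eq.1 h1
    have hs' : n • s = -(b : A) + t := hs
    refine ⟨b, AddSubgroup.subset_closure ⟨_, rfl⟩, s, ?_, by rw [hs']; abel⟩
    refine mem_pComponent_of_nsmul ?_
    rw [hs']
    exact T.add_mem (T.neg_mem b.2) ht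
  obtain ⟨e, he⟩ : ∃ e : ℕ, ∀ b ∈ B, n ^ e • b = 0 := by
    have : ∀ b : B, ∃ k : ℕ, n ^ k • (b : A) = 0 := fun b => hBT b.2
    choose k hk using this
    obtain ⟨e, he⟩ := (Set.finite_range k).bddAbove
    refine ⟨e, fun b hb => ?_⟩
    obtain ⟨d, hd⟩ := Nat.exists_eq_add_of_le (he ⟨⟨b, hb⟩, rfl⟩)
    rw [hd, add_comm, pow_add, mul_smul, hk ⟨b, hb⟩, smul_zero]
  -- Since n^e kills B, the equation T = B + nT makes n^e T divisible by n, hence divisible, hence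
  -- zero. Iterating the same equation e times then gives T = B.
  let D : AddSubgroup A := T.map (nsmulAddMonoidHom (n ^ e))
  have hD : D = ⊥ := by
    refine hred D fun m hm x => ?_
    have h := exists_nsmul_eq_of_primary (D := D) (n := n) ?_ ?_ m hm x x.2
    · obtain ⟨y, hy, hyx⟩ := h
      exact ⟨⟨y, hy⟩, Subtype.ext hyx⟩
    · rintro _ ⟨t, ht, rfl⟩
      obtain ⟨b, hb, s, hs, rfl⟩ := hsum t ht
      refine ⟨_, ⟨s, hs, rfl⟩, ?_⟩
      simp only [nsmulAddMonoidHom_apply, smul_add, he b hb, zero_add]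
      rw [smul_comm]
    · rintro _ ⟨t, ⟨k, hk⟩, rfl⟩
      exact ⟨k, by simp only [nsmulAddMonoidHom_apply]; rw [smul_comm, hk, smul_zero]⟩
  have hT : T ≤ B := by
    have key : ∀ j : ℕ, ∀ t ∈ T, ∃ b ∈ B, ∃ s ∈ T, t = b + n ^ j • s := by
      intro j
      induction j with
      | zero => exact fun t ht => ⟨0, B.zero_mem, t, ht, by simp⟩
      | succ j ih =>
        intro t ht
        obtain ⟨b, hb, s, hs, rfl⟩ := ih t ht
        obtain ⟨b', hb', s', hs', rfl⟩ := hsum s hs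
        exact ⟨b + n ^ j • b', B.add_mem hb (B.nsmul_mem hb' _), s', hs', by
          rw [smul_add, ← mul_smul, ← pow_succ, add_assoc]⟩
    intro t ht
    obtain ⟨b, hb, s, hs, rfl⟩ := key e t ht
    have : n ^ e • s ∈ D := ⟨s, hs, rfl⟩
    rw [hD, AddSubgroup.mem_bot] at this
    rwa [this, add_zero]
  exact Finite.of_injective (fun t : T => (⟨t, hT t.2⟩ : B)) fun a b h =>
    Subtype.ext (congrArg (fun z : B => (z : A)) h)

theorem mem_nComponent_of_nsmul_eq_zero {n : ℕ} (m : ℕ) :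
    0 < m → m.primeFactors ⊆ n.primeFactors → ∀ x : A, m • x = 0 → x ∈ nComponent A n := by
  induction m using Nat.recOnPosPrimePosCoprime with
  | prime_pow p k hp hk =>
    intro _ hsub x hx
    have hpn : p ∈ n.primeFactors := hsub (by simp [Nat.primeFactors_prime_pow hk.ne' hp])
    exact (le_iSup₂_of_le (f := fun p (_ : p ∈ n.primeFactors) => pComponent A p)
      p hpn le_rfl) ⟨k, hx⟩
  | zero => intro h; omega
  | one =>
    intro _ _ x hx
    rw [one_smul] at hx
    rw [hx]
    exact zero_mem _
  | coprime a b ha hb hab iha ihb =>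
    intro _ hsub x hx
    rw [hab.primeFactors_mul] at hsub
    obtain ⟨u, v, huv⟩ := Nat.isCoprime_iff_coprime.2 hab
    have h1 : (u * a) • x + (v * b) • x = x := by rw [← add_smul, huv, one_smul]
    rw [← h1]
    refine add_mem ?_ ?_
    · refine ihb (by omega) (Finset.union_subset_right hsub) _ ?_
      rw [← natCast_zsmul, ← mul_smul, mul_left_comm, mul_smul, mul_comm, ← Nat.cast_mul,
        natCast_zsmul, hx, smul_zero]
    · refine iha (by omega) (Finset.union_subset_left hsub) _ ?_
      rw [← natCast_zsmul, ← mul_smul, mul_left_comm, mul_smul, ← Nat.cast_mul,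
        natCast_zsmul, hx, smul_zero]

theorem nComponent_eq_pComponent {n : ℕ} (hn : 0 < n) : nComponent A n = pComponent A n := by
  refine le_antisymm ?_ ?_
  · refine iSup₂_le fun p hp x ⟨k, hk⟩ => ⟨k, ?_⟩
    obtain ⟨c, hc⟩ := pow_dvd_pow_of_dvd (Nat.dvd_of_mem_primeFactors hp) k
    rw [hc, mul_comm, mul_smul, hk, smul_zero]
  · rintro x ⟨k, hk⟩
    refine mem_nComponent_of_nsmul_eq_zero (n ^ k) (pow_pos hn k) ?_ x hk
    intro p hp
    have h := Nat.prime_of_mem_primeFactors hp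
    exact Nat.mem_primeFactors.2 ⟨h, h.dvd_of_dvd_pow (Nat.dvd_of_mem_primeFactors hp), hn.ne'⟩

/-- The intersection U of all nA is divisible: z in U has only finitely many n-th parts y. If none
lay in U, each would fail to be divisible by some m(y); but z is divisible by n times the product of
the m(y), which yields an n-th part divisible by all of them. -/
theorem eq_zero_of_forall_exists_nsmul (hred : IsReducedGroup A)
    (hfin : ∀ n : ℕ, 0 < n → Finite (pComponent A n)) (x : A)
    (hx : ∀ n : ℕ, 0 < n → ∃ y : A, n • y = x) : x = 0 := by
  let U : AddSubgroup A := ⨅ n : {n : ℕ // 0 < n}, nMul A n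
  have hU : ∀ z : A, z ∈ U ↔ ∀ n : ℕ, 0 < n → ∃ y : A, n • y = z := fun z => by
    simp only [U, AddSubgroup.mem_iInf, Subtype.forall, mem_nMul]
  have h0 : U = ⊥ := by
    refine hred U fun n hn z => ?_
    obtain ⟨z, hz⟩ := z
    have hz' := (hU z).1 hz
    by_contra hcon
    have hne : ∀ y : A, n • y = z → ∃ m : ℕ, 0 < m ∧ ∀ w : A, m • w ≠ y := by
      intro y hy
      by_contra! h
      exact hcon ⟨⟨y, (hU y).2 h⟩, Subtype.ext hy⟩
    have hfinite : {y : A | n • y = z}.Finite := by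
      obtain ⟨y₀, hy₀⟩ := hz' n hn
      have := hfin n hn
      refine ((Set.toFinite (pComponent A n : Set A)).image (fun t => y₀ + t)).subset ?_
      intro y hy
      refine ⟨y - y₀, ⟨1, ?_⟩, by simp⟩
      rw [pow_one, smul_sub, hy₀, (hy : n • y = z), sub_self]
    choose! m hm hmw using hne
    let N := ∏ y ∈ hfinite.toFinset, m y
    have hN : 0 < N := Finset.prod_pos fun y hy => hm y (by simpa using hy)
    obtain ⟨w, hw⟩ := hz' (n * N) (Nat.mul_pos hn hN)
    rw [mul_smul] at hw
    obtain ⟨c, hc⟩ := Finset.dvd_prod_of_mem m (hfinite.mem_toFinset.2 hw)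
    refine hmw _ hw (c • w) ?_
    rw [← mul_smul, ← hc]
  have := (hU x).2 hx
  rwa [h0] at this

/-- A homomorphism into `ℤ/d` extends along `j` when it kills everything that becomes divisible
by `d`. -/
theorem exists_extension_zmod {B C : Type*} [AddCommGroup B] [AddCommGroup C] (j : B →+ C)
    {d : ℕ} (hd : 0 < d) (χ : B →+ ZMod d) (h : ∀ b c, j b = d • c → χ b = 0) :
    ∃ χ' : C →+ ZMod d, ∀ b, χ' (j b) = χ b := by
  have : NeZero d := ⟨hd.ne'⟩
  have : Fact ((0 : ℚ) < 1) := ⟨one_pos⟩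
  -- This identifies ℤ/d with the d-torsion of the injective group ℚ/ℤ. An extension defined on C/dC
  -- has values killed by d, so it factors back through ℤ/d.
  let κ : ZMod d →+ AddCircle (1 : ℚ) := ZMod.lift d
    ⟨zmultiplesHom _ (((1 / d : ℚ) : ℚ) : AddCircle (1 : ℚ)), by
      simp only [zmultiplesHom_apply, natCast_zsmul]
      rw [← AddCircle.coe_nsmul, nsmul_eq_mul, mul_one_div_cancel (by exact_mod_cast hd.ne')]
      exact AddCircle.coe_period 1⟩
  have hκ : ∀ z : ℤ, κ z = ((z / d : ℚ) : AddCircle (1 : ℚ)) := fun z => by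
    simp only [κ, ZMod.lift_coe, zmultiplesHom_apply]
    rw [← AddCircle.coe_zsmul, zsmul_eq_mul, mul_one_div]
  have hκinj : Function.Injective κ := by
    rw [injective_iff_map_eq_zero]
    intro a ha
    obtain ⟨z, rfl⟩ := ZMod.intCast_surjective a
    rw [hκ, AddCircle.coe_eq_zero_iff] at ha
    obtain ⟨n, hn⟩ := ha
    have hd' : (d : ℚ) ≠ 0 := by exact_mod_cast hd.ne'
    rw [zsmul_eq_mul, mul_one, eq_div_iff hd'] at hn
    rw [ZMod.intCast_zmod_eq_zero_iff_dvd]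
    exact ⟨n, by rw [mul_comm]; exact_mod_cast hn.symm⟩
  have hκrange : ∀ u : AddCircle (1 : ℚ), d • u = 0 → ∃ a, κ a = u := by
    intro u hu
    obtain ⟨m, -, rfl⟩ := (AddCircle.nsmul_eq_zero_iff hd).1 hu
    exact ⟨((m : ℤ) : ZMod d), by rw [hκ]; simp⟩
  let S : AddSubgroup C := (nsmulAddMonoidHom d : C →+ C).range
  let j' : B →+ C ⧸ S := (QuotientAddGroup.mk' S).comp j
  have hj' : ∀ b, j' b = 0 → χ b = 0 := by
    intro b hb
    obtain ⟨c, hc⟩ := (QuotientAddGroup.eq_zero_iff (j b)).1 hb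
    exact h b c hc.symm
  let χ₁ : (B ⧸ j'.ker) →+ AddCircle (1 : ℚ) :=
    QuotientAddGroup.lift j'.ker (κ.comp χ) fun b hb => by
      simp [hj' b hb]
  obtain ⟨ξ, hξ⟩ := CharacterModule.dual_surjective_of_injective (R := ℤ)
    (QuotientAddGroup.kerLift j').toIntLinearMap (QuotientAddGroup.kerLift_injective j') χ₁
  let ξ' : (C ⧸ S) →+ AddCircle (1 : ℚ) := ξ
  have hξ' : ∀ b, ξ' (j' b) = κ (χ b) := fun b =>
    DFunLike.congr_fun hξ (QuotientAddGroup.mk b)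
  have hex : ∀ c : C, ∃ a, κ a = ξ' (QuotientAddGroup.mk c) := fun c => by
    refine hκrange _ ?_
    rw [← map_nsmul, ← QuotientAddGroup.mk_nsmul]
    have : (QuotientAddGroup.mk (d • c) : C ⧸ S) = 0 :=
      (QuotientAddGroup.eq_zero_iff _).2 ⟨c, rfl⟩
    rw [this, map_zero]
  choose χ' hχ' using hex
  refine ⟨AddMonoidHom.mk' χ' fun a b => hκinj ?_, fun b => hκinj ?_⟩
  · rw [map_add, hχ', hχ', hχ', QuotientAddGroup.mk_add, map_add]
  · exact (hχ' _).trans (hξ' b)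

end Basics

/-! ### Splitting off primary parts, self-smallness, and maps to ℤ -/

section Structure

variable {A : Type u} [AddCommGroup A]

/-- A finite `n`-primary part is a direct summand. -/
theorem exists_isCompl_pComponent {n : ℕ} (hfin : Finite (pComponent A n)) :
    ∃ C : AddSubgroup A, IsCompl (pComponent A n) C := by
  classical
  obtain ⟨ι, _, d, hd, ⟨e⟩⟩ := AddCommGroup.equiv_directSum_zmod_of_finite' (pComponent A n)
  let χ : ∀ i, pComponent A n →+ ZMod (d i) := fun i =>
    (DFinsupp.evalAddMonoidHom i).comp e.toAddMonoidHom
  have hdn : ∀ i, ∃ k : ℕ, d i ∣ n ^ k := fun i => by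
    let t := e.symm (DirectSum.of (fun i => ZMod (d i)) i 1)
    obtain ⟨k, hk⟩ := t.2
    refine ⟨k, ?_⟩
    have h1 : n ^ k • t = 0 := Subtype.ext (by simpa using hk)
    have h2 : n ^ k • e t = 0 := by rw [← map_nsmul, h1, map_zero]
    have h3 := DFunLike.congr_fun h2 i
    simp only [t, AddEquiv.apply_symm_apply] at h3
    rw [DFinsupp.nsmul_apply, DirectSum.of_eq_same] at h3
    rw [← ZMod.natCast_eq_zero_iff]
    rwa [nsmul_one] at h3
  have hext : ∀ i, ∃ χ' : A →+ ZMod (d i), ∀ b : pComponent A n, χ' b = χ i b := fun i => by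
    -- Purity: as d i divides a power of n, any c with d i • c in the n-primary part lies there
    -- itself, so the coordinate in ℤ/d i vanishes on d i • c.
    refine exists_extension_zmod (pComponent A n).subtype (by have := hd i; omega) (χ i) ?_
    intro b c hbc
    obtain ⟨k, s, hs⟩ := hdn i
    have hc : c ∈ pComponent A n := by
      obtain ⟨l, hl⟩ := b.2
      refine ⟨l + k, ?_⟩
      have : d i • c = b := hbc.symm
      rw [pow_add, hs, mul_smul, mul_comm, mul_smul, this, smul_comm, hl, smul_zero]
    have : b = d i • (⟨c, hc⟩ : pComponent A n) := Subtype.ext hbc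
    rw [this, map_nsmul, nsmul_eq_mul, ZMod.natCast_self, zero_mul]
  choose χ' hχ' using hext
  -- The extended coordinates together form a retraction onto the n-primary part; this is its
  -- kernel.
  refine ⟨⨅ i, (χ' i).ker, ?_⟩
  have hχ0 : ∀ b : pComponent A n, (∀ i, χ i b = 0) → b = 0 := fun b hb => by
    apply e.injective
    rw [map_zero]
    exact DFinsupp.ext hb
  refine IsCompl.of_le ?_ ?_
  · rintro x ⟨hx, hx'⟩
    have : (⟨x, hx⟩ : pComponent A n) = 0 := hχ0 _ fun i => by
      rw [← hχ' i]
      have hx' : x ∈ ⨅ i, (χ' i).ker := hx'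
      exact (AddSubgroup.mem_iInf.1 hx') i
    exact congrArg Subtype.val this
  · intro x _
    let y : DirectSum ι fun i => ZMod (d i) := DFinsupp.equivFunOnFintype.symm fun i => χ' i x
    have hy : ∀ i, χ i (e.symm y) = χ' i x := fun i => by
      simp only [χ, y, AddMonoidHom.comp_apply, AddEquiv.coe_toAddMonoidHom,
        AddEquiv.apply_symm_apply]
      rfl
    rw [AddSubgroup.mem_sup]
    refine ⟨e.symm y, (e.symm y).2, x - e.symm y, ?_, by abel⟩
    rw [AddSubgroup.mem_iInf]
    intro i
    rw [AddMonoidHom.mem_ker, map_sub, hχ' i, hy, sub_self]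

theorem IsReducedGroup.hom_eq_zero {B : Type*} [AddCommGroup B] (hred : IsReducedGroup A)
    (f : B →+ A) (hf : ∀ n : ℕ, 0 < n → ∀ b, ∃ c, f b = n • f c) : f = 0 := by
  have : f.range = ⊥ := hred f.range fun n hn x => by
    obtain ⟨_, b, rfl⟩ := x
    obtain ⟨c, hc⟩ := hf n hn b
    exact ⟨⟨f c, c, rfl⟩, Subtype.ext hc.symm⟩
  exact AddMonoidHom.range_eq_bot_iff.1 this

/-- The finitely many generators of F meet only finitely many coordinates. Every other coordinate
map kills F, so its image is divisible and therefore zero. -/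
theorem IsReducedGroup.isSelfSmall (hred : IsReducedGroup A) {F : AddSubgroup A} (hF : F.FG)
    (hdiv : ∀ n : ℕ, 0 < n → ∀ x : A, ∃ f ∈ F, ∃ y : A, x = f + n • y) : IsSelfSmall A := by
  classical
  intro I
  have happly : ∀ (g : I →₀ (A →+ A)) (x : A) (i : I), selfSmallMap A I g x i = g i x := by
    intro g x i
    induction g using Finsupp.induction_linear with
    | zero => simp
    | add f g hf hg => rw [map_add, AddMonoidHom.add_apply, Finsupp.add_apply, hf, hg]; rfl
    | single j f =>
      have : selfSmallMap A I (Finsupp.single j f) x = Finsupp.single j (f x) := by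
        simp [selfSmallMap]
      rw [this, Finsupp.single_apply, Finsupp.single_apply]
      split_ifs <;> rfl
  refine ⟨fun g g' h => ?_, fun f => ?_⟩
  · ext i x
    rw [← happly, h, happly]
  · let f' : I → (A →+ A) := fun i => (Finsupp.applyAddHom i).comp f
    obtain ⟨S, hS, hSfin⟩ := (AddSubgroup.fg_iff F).1 hF
    let J : Set I := ⋃ s ∈ S, ((f s).support : Set I)
    have hJ : J.Finite := hSfin.biUnion fun s _ => Finset.finite_toSet _
    have hzero : ∀ i, i ∉ J → f' i = 0 := by
      intro i hi
      have hker : F ≤ (f' i).ker := by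
        rw [← hS, AddSubgroup.closure_le]
        intro s hs
        by_contra hne
        exact hi (Set.mem_biUnion hs (Finsupp.mem_support_iff.2 hne))
      refine hred.hom_eq_zero _ fun n hn x => ?_
      obtain ⟨a, ha, y, rfl⟩ := hdiv n hn x
      exact ⟨y, by rw [map_add, (hker ha : f' i a = 0), zero_add, map_nsmul]⟩
    refine ⟨Finsupp.onFinset hJ.toFinset f' fun i hi => ?_, ?_⟩
    · by_contra hne
      exact hi (hzero i (by simpa using hne))
    · ext x i
      rw [happly]
      rfl

/-- A nonzero image is dℤ, hence free, so a preimage of d generates an infinite cyclic complement of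
the kernel. -/
theorem NoFreeSummand.hom_int_eq_zero (h : NoFreeSummand A) (f : A →+ ℤ) : f = 0 := by
  obtain ⟨d, hd⟩ := Int.subgroup_cyclic f.range
  have hd' : f.range = AddSubgroup.zmultiples d := by
    rw [hd, AddSubgroup.zmultiples_eq_closure]
  obtain ⟨x, hx⟩ : d ∈ f.range := by rw [hd']; exact AddSubgroup.mem_zmultiples d
  by_cases hd0 : d = 0
  · subst hd0
    rw [AddSubgroup.zmultiples_zero_eq_bot] at hd'
    exact AddMonoidHom.range_eq_bot_iff.1 hd'
  exfalso
  have hinj : Function.Injective (zmultiplesHom A x) := by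
    rw [injective_iff_map_eq_zero]
    intro k hk
    have := congrArg f hk
    rw [zmultiplesHom_apply, map_zsmul, hx, map_zero, smul_eq_mul] at this
    exact (mul_eq_zero.1 this).resolve_right hd0
  have hfree : Module.Free ℤ (zmultiplesHom A x).range :=
    Module.Free.of_equiv (AddMonoidHom.ofInjective hinj).toIntLinearEquiv
  have hcompl : IsCompl (zmultiplesHom A x).range f.ker := by
    refine IsCompl.of_le ?_ ?_
    · rintro _ ⟨⟨k, rfl⟩, hk⟩
      have hk : f (zmultiplesHom A x k) = 0 := hk
      rw [zmultiplesHom_apply, map_zsmul, hx, smul_eq_mul] at hk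
      rw [(mul_eq_zero.1 hk).resolve_right hd0]
      exact map_zero _
    · intro y _
      have hy : f y ∈ AddSubgroup.zmultiples d := hd' ▸ ⟨y, rfl⟩
      obtain ⟨k, hk⟩ := hy
      rw [AddSubgroup.mem_sup]
      refine ⟨k • x, ⟨k, rfl⟩, y - k • x, ?_, by abel⟩
      rw [AddMonoidHom.mem_ker, map_sub, map_zsmul, hx, ← hk, sub_self]
  have := h _ _ hcompl hfree
  have hx0 : x ∈ (zmultiplesHom A x).range := ⟨1, by simp⟩
  rw [this, AddSubgroup.mem_bot] at hx0
  rw [hx0, map_zero] at hx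
  exact hd0 hx.symm

end Structure

/-! ### Tame groups: the properties of G that the construction of H needs -/

/-- Countable groups without free quotients that are Hausdorff in the `ℤ`-adic topology. -/
structure IsTame (A : Type u) [AddCommGroup A] : Prop where
  countable : Countable A
  countable_hom : Countable (A →+ ℚ)
  hausdorff : ∀ x : A, (∀ n : ℕ, 0 < n → ∃ y : A, n • y = x) → x = 0
  hom_int : ∀ f : A →+ ℤ, f = 0

section

variable {A : Type u} [AddCommGroup A]

theorem countable_hom_rat {F : AddSubgroup A} (hF : F.FG)
    (hfull : ∀ x : A, ∃ m : ℕ, 0 < m ∧ m • x ∈ F) : Countable (A →+ ℚ) := by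
  obtain ⟨S, hS, hSfin⟩ := (AddSubgroup.fg_iff F).1 hF
  have : Finite S := hSfin
  refine Function.Injective.countable (f := fun (f : A →+ ℚ) (s : S) => f s) ?_
  intro f g hfg
  have hle : F ≤ (f - g).ker := by
    rw [← hS, AddSubgroup.closure_le]
    intro s hs
    have := congrFun hfg ⟨s, hs⟩
    simpa [sub_eq_zero] using this
  ext x
  obtain ⟨m, hm, hx⟩ := hfull x
  have h := hle hx
  rw [AddMonoidHom.mem_ker, map_nsmul, nsmul_eq_mul, mul_eq_zero] at h
  have hm' : (m : ℚ) ≠ 0 := by exact_mod_cast hm.ne'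
  simpa [sub_eq_zero] using h.resolve_left hm'

/-- Every element solves m • x = f with f in the countable group F, and the solutions lie in one
coset of the finite m-primary part. -/
theorem countable_of_full {F : AddSubgroup A} (hF : F.FG)
    (hfull : ∀ x : A, ∃ m : ℕ, 0 < m ∧ m • x ∈ F)
    (hfin : ∀ n : ℕ, 0 < n → Finite (pComponent A n)) : Countable A := by
  have hFc : Countable F := by
    have : AddGroup.FG F := (AddGroup.fg_iff_addSubgroup_fg F).2 hF
    have : Module.Finite ℤ F := Module.Finite.iff_addGroup_fg.2 this
    obtain ⟨n, f, hf⟩ := Module.Finite.exists_fin' ℤ F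
    exact hf.countable
  have hcov : (Set.univ : Set A) ⊆ ⋃ (m : {m : ℕ // 0 < m}), ⋃ (f : F),
      {x : A | (m : ℕ) • x = f} := by
    intro x _
    obtain ⟨m, hm, hx⟩ := hfull x
    exact Set.mem_iUnion.2 ⟨⟨m, hm⟩, Set.mem_iUnion.2 ⟨⟨_, hx⟩, rfl⟩⟩
  refine Set.countable_univ_iff.1 (Set.Countable.mono hcov ?_)
  refine Set.countable_iUnion fun m => Set.countable_iUnion fun f => ?_
  obtain ⟨m, hm⟩ := m
  by_cases hne : ∃ y : A, m • y = f
  · obtain ⟨y, hy⟩ := hne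
    have := hfin m hm
    refine (((Set.toFinite (pComponent A m : Set A)).image (fun t => y + t)).subset ?_).countable
    intro x hx
    refine ⟨x - y, ⟨1, ?_⟩, by simp⟩
    rw [pow_one, smul_sub, hy, (hx : m • x = f), sub_self]
  · convert Set.countable_empty
    rw [Set.eq_empty_iff_forall_notMem]
    exact fun x hx => hne ⟨x, hx⟩

theorem IsQuotientDivisible.isTame (h : IsQuotientDivisible A) (hred : IsReducedGroup A)
    (hfree : NoFreeSummand A) : IsTame A := by
  obtain ⟨F, hF, hfull, hdiv⟩ := h.exists_fg
  have hfin : ∀ n : ℕ, 0 < n → Finite (pComponent A n) := fun n hn =>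
    finite_pComponent hred hn (finite_quotient_nMul hF hn (hdiv n hn))
  exact ⟨countable_of_full hF hfull hfin, countable_hom_rat hF hfull,
    eq_zero_of_forall_exists_nsmul hred hfin, hfree.hom_int_eq_zero⟩

end

/-! ### Rank-two groups attached to profinite integers -/

/-- A residue class `residue + modulus ℤ`, an approximation to a profinite integer. -/
structure ResidueApprox where
  modulus : ℕ
  pos : 0 < modulus
  residue : ℤ

/-- Larger means finer: the class of q is contained in that of p. -/
instance : Preorder ResidueApprox where
  le p q := p.modulus ∣ q.modulus ∧ (p.modulus : ℤ) ∣ q.residue - p.residue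
  le_refl p := ⟨dvd_rfl, by simp⟩
  le_trans p q r h h' := ⟨h.1.trans h'.1, by
    have h1 : (p.modulus : ℤ) ∣ r.residue - q.residue :=
      (Int.natCast_dvd_natCast.2 h.1).trans h'.2
    have := h.2.add h1
    rwa [sub_add_sub_cancel'] at this⟩

namespace ResidueApprox

/-- The rational pairs `(x, y)` with `nx` and `y - ax` integers, for the residue class of `a`
modulo `n`. -/
def lattice (p : ResidueApprox) : AddSubgroup (ℚ × ℚ) where
  carrier := {w | (∃ k : ℤ, p.modulus * w.1 = k) ∧ ∃ l : ℤ, w.2 - p.residue * w.1 = l}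
  zero_mem' := ⟨⟨0, by simp⟩, 0, by simp⟩
  add_mem' := by
    rintro v w ⟨⟨k, hk⟩, l, hl⟩ ⟨⟨k', hk'⟩, l', hl'⟩
    refine ⟨⟨k + k', ?_⟩, l + l', ?_⟩
    · push_cast; rw [← hk, ← hk', Prod.fst_add]; ring
    · push_cast; rw [← hl, ← hl', Prod.fst_add, Prod.snd_add]; ring
  neg_mem' := by
    rintro w ⟨⟨k, hk⟩, l, hl⟩
    refine ⟨⟨-k, ?_⟩, -l, ?_⟩
    · push_cast; rw [← hk, Prod.fst_neg]; ring
    · push_cast; rw [← hl, Prod.fst_neg, Prod.snd_neg]; ring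

theorem lattice_mono {p q : ResidueApprox} (h : p ≤ q) : p.lattice ≤ q.lattice := by
  rintro w ⟨⟨k, hk⟩, l, hl⟩
  obtain ⟨⟨c, hc⟩, d, hd⟩ := h
  refine ⟨⟨c * k, ?_⟩, l - d * k, ?_⟩
  · rw [hc]; push_cast; rw [← hk]; ring
  · have : (q.residue : ℚ) = p.residue + p.modulus * d := by
      have : q.residue = p.residue + p.modulus * d := by rw [← hd]; ring
      rw [this]; push_cast; ring
    rw [this]; push_cast; rw [← hl, ← hk]; ring

/-- The union of the lattices of a sequence of residue classes. -/
def limit (s : ℕ → ResidueApprox) : AddSubgroup (ℚ × ℚ) := ⨆ i, (s i).lattice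

/-- A nested sequence of residue classes whose limit is a profinite integer that is a root of no
nonzero quadratic polynomial over `ℤ`. -/
structure IsGeneric (s : ℕ → ResidueApprox) : Prop where
  mono : Monotone s
  exists_dvd : ∀ N : ℕ, 0 < N → ∃ i, N ∣ (s i).modulus
  quadratic : ∀ a b c : ℤ,
    (∀ i, ((s i).modulus : ℤ) ∣ a + b * (s i).residue + c * (s i).residue ^ 2) →
      a = 0 ∧ b = 0 ∧ c = 0

section Limit

variable {s : ℕ → ResidueApprox}

theorem mem_limit (hs : Monotone s) {w : ℚ × ℚ} : w ∈ limit s ↔ ∃ i, w ∈ (s i).lattice :=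
  AddSubgroup.mem_iSup_of_directed 
    (Monotone.directed_le fun _ _ h => lattice_mono (hs h))

theorem exists_le_mem (hs : Monotone s) {w : ℚ × ℚ} (hw : w ∈ limit s) (i : ℕ) :
    ∃ j, i ≤ j ∧ w ∈ (s j).lattice := by
  obtain ⟨j, hj⟩ := (mem_limit hs).1 hw
  exact ⟨max i j, le_max_left _ _, lattice_mono (hs (le_max_right _ _)) hj⟩

theorem zero_one_mem (hs : Monotone s) : ((0, 1) : ℚ × ℚ) ∈ limit s :=
  (mem_limit hs).2 ⟨0, ⟨0, by simp⟩, 1, by simp⟩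

theorem one_zero_mem (hs : Monotone s) : ((1, 0) : ℚ × ℚ) ∈ limit s :=
  (mem_limit hs).2 ⟨0, ⟨(s 0).modulus, by simp⟩, -(s 0).residue, by simp⟩

theorem modulus_ne_zero (p : ResidueApprox) : (p.modulus : ℚ) ≠ 0 := by
  exact_mod_cast p.pos.ne'

theorem inv_modulus_mem (hs : Monotone s) (i : ℕ) :
    ((1 / (s i).modulus, (s i).residue / (s i).modulus) : ℚ × ℚ) ∈ limit s := by
  have := modulus_ne_zero (s i)
  refine (mem_limit hs).2 ⟨i, ⟨1, by field_simp; simp⟩, 0, ?_⟩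
  simp only [Int.cast_zero]
  ring

/-- The element `(0, 1)`. -/
def vert (hs : Monotone s) : limit s := ⟨(0, 1), zero_one_mem hs⟩

/-- The element `(1, 0)`. -/
def horiz (hs : Monotone s) : limit s := ⟨(1, 0), one_zero_mem hs⟩

/-- The element `(1/n, a/n)` for the `i`-th residue class `a + nℤ`. -/
def frac (hs : Monotone s) (i : ℕ) : limit s := ⟨_, inv_modulus_mem hs i⟩

theorem nsmul_frac (hs : Monotone s) (i : ℕ) :
    (s i).modulus • frac hs i = horiz hs + (s i).residue • vert hs := by
  have := modulus_ne_zero (s i)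
  refine Subtype.ext (Prod.ext ?_ ?_)
  · simp [frac, horiz, vert, this]
  · simp [frac, horiz, vert]
    field_simp

theorem map_nsmul_frac (hs : Monotone s) {B : Type*} [AddCommGroup B] (f : limit s →+ B) (i : ℕ) :
    (s i).modulus • f (frac hs i) = f (horiz hs) + (s i).residue • f (vert hs) := by
  rw [← map_nsmul, nsmul_frac, map_add, map_zsmul]

theorem mem_int_of_fst_eq_zero (hs : Monotone s) {w : ℚ × ℚ} (hw : w ∈ limit s) (h : w.1 = 0) :
    ∃ l : ℤ, w.2 = l := by
  obtain ⟨i, -, l, hl⟩ := (mem_limit hs).1 hw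
  exact ⟨l, by rw [← hl, h]; ring⟩

instance : IsAddTorsionFree (limit s) :=
  Function.Injective.isAddTorsionFree (limit s).subtype Subtype.val_injective

/-- Modulo `(0, 1)` the limit is divisible. -/
theorem exists_nsmul_sub (hs : IsGeneric s) {m : ℕ} (hm : 0 < m) (w : limit s) :
    ∃ (v : limit s) (l : ℤ), w = m • v + l • vert hs.mono := by
  obtain ⟨⟨x, y⟩, hw⟩ := w
  -- With modulus m * x.den * c, the multiple c * x.num of `frac` has first coordinate x / m. What
  -- is left over has first coordinate zero and is an integer multiple of `vert`.
  obtain ⟨i, hi⟩ := hs.exists_dvd (m * x.den) (Nat.mul_pos hm x.pos)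
  obtain ⟨c, hc⟩ := hi
  have h1 : m • ((c * x.num : ℤ) • frac hs.mono i : limit s).1.1 = x := by
    have hmod := modulus_ne_zero (s i)
    have hm' : (m : ℚ) ≠ 0 := by exact_mod_cast hm.ne'
    have hcq : ((s i).modulus : ℚ) = m * x.den * c := by exact_mod_cast hc
    have hden : (x.den : ℚ) ≠ 0 := by exact_mod_cast x.den_nz
    have hc0 : (c : ℚ) ≠ 0 := by
      intro h; rw [h, mul_zero] at hcq; exact hmod hcq
    simp only [frac, AddSubgroup.coe_zsmul, Prod.smul_fst]
    simp only [nsmul_eq_mul, zsmul_eq_mul]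
    rw [hcq]
    push_cast
    field_simp
    rw [mul_comm, Rat.mul_den_eq_num]
  set v : limit s := (c * x.num : ℤ) • frac hs.mono i
  obtain ⟨l, hl⟩ := mem_int_of_fst_eq_zero hs.mono
    ((⟨(x, y), hw⟩ : limit s) - m • v).2 (by simpa [sub_eq_zero] using h1.symm)
  refine ⟨v, l, ?_⟩
  rw [← sub_eq_iff_eq_add']
  refine Subtype.ext (Prod.ext ?_ ?_)
  · simpa [vert, sub_eq_zero] using h1.symm
  · rw [hl]; simp [vert]

theorem hom_eq_zero (hs : Monotone s) {B : Type*} [AddCommGroup B] [IsAddTorsionFree B]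
    (f : limit s →+ B) (h₁ : f (horiz hs) = 0) (h₂ : f (vert hs) = 0) : f = 0 := by
  ext w
  have hden : w.1.1.den * w.1.2.den ≠ 0 := mul_ne_zero w.1.1.den_nz w.1.2.den_nz
  have : (w.1.1.den * w.1.2.den) • w =
      (w.1.1.num * w.1.2.den) • horiz hs + (w.1.2.num * w.1.1.den) • vert hs := by
    refine Subtype.ext (Prod.ext ?_ ?_)
    · simp only [horiz, vert, AddSubgroup.coe_nsmul, AddSubgroup.coe_add, AddSubgroup.coe_zsmul,
        Prod.smul_fst, Prod.fst_add]
      simp only [nsmul_eq_mul, zsmul_eq_mul]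
      push_cast
      linear_combination (w.1.2.den : ℚ) * Rat.mul_den_eq_num w.1.1
    · simp only [horiz, vert, AddSubgroup.coe_nsmul, AddSubgroup.coe_add, AddSubgroup.coe_zsmul,
        Prod.smul_snd, Prod.snd_add]
      simp only [nsmul_eq_mul, zsmul_eq_mul]
      push_cast
      linear_combination (w.1.1.den : ℚ) * Rat.mul_den_eq_num w.1.2
  have h := congrArg f this
  rw [map_nsmul, map_add, map_zsmul, map_zsmul, h₁, h₂, smul_zero, smul_zero, add_zero] at h
  exact (nsmul_eq_zero_iff_right hden).1 h

/-- The images of the fractions make f(`horiz`) + a f(`vert`) divisible by every modulus: a linear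
relation for a. -/
theorem IsGeneric.hom_int (hs : IsGeneric s) (f : limit s →+ ℤ) : f = 0 := by
  have h := hs.quadratic (f (horiz hs.mono)) (f (vert hs.mono)) 0 fun i => by
    have := map_nsmul_frac hs.mono f i
    simp only [nsmul_eq_mul, zsmul_eq_mul, Int.cast_id] at this
    exact ⟨f (frac hs.mono i), by rw [this]; ring⟩
  exact hom_eq_zero hs.mono f h.1 h.2.1

/-- A homomorphism given by rational pairs `(α, γ)` and `(β, δ)` on the basis is scalar. -/
theorem IsGeneric.scalar (hs : IsGeneric s) (f : limit s →+ limit s) :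
    (f (vert hs.mono)).1.1 = 0 ∧ (f (horiz hs.mono)).1.2 = 0 ∧
      (f (horiz hs.mono)).1.1 = (f (vert hs.mono)).1.2 := by
  set α := (f (horiz hs.mono)).1.1 with hα
  set γ := (f (horiz hs.mono)).1.2 with hγ
  set β := (f (vert hs.mono)).1.1 with hβ
  set δ := (f (vert hs.mono)).1.2 with hδ
  obtain ⟨D, hD, a, b, c, d, ha, hb, hc, hd⟩ : ∃ D : ℤ, D ≠ 0 ∧ ∃ a b c d : ℤ,
      D * α = a ∧ D * β = b ∧ D * γ = c ∧ D * δ = d := by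
    refine ⟨α.den * β.den * γ.den * δ.den, by simp, α.num * (β.den * γ.den * δ.den),
      β.num * (α.den * γ.den * δ.den), γ.num * (α.den * β.den * δ.den),
      δ.num * (α.den * β.den * γ.den), ?_, ?_, ?_, ?_⟩ <;> push_cast
    · linear_combination ((β.den * γ.den * δ.den : ℚ)) * Rat.mul_den_eq_num α
    · linear_combination ((α.den * γ.den * δ.den : ℚ)) * Rat.mul_den_eq_num β
    · linear_combination ((α.den * β.den * δ.den : ℚ)) * Rat.mul_den_eq_num γ
    · linear_combination ((α.den * β.den * γ.den : ℚ)) * Rat.mul_den_eq_num δ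
  have key := hs.quadratic c (d - a) (-b) fun i => by
    have h := map_nsmul_frac hs.mono f i
    -- The image may only appear in a later lattice; its residue agrees with the i-th modulo the
    -- i-th modulus. In the limit the condition reads γ + δa - a(α + βa) = 0, and D clears the
    -- denominators.
    obtain ⟨j, hij, -, l, hl⟩ := exists_le_mem hs.mono (f (frac hs.mono i)).2 i
    set x := (f (frac hs.mono i)).1.1
    set y := (f (frac hs.mono i)).1.2
    have hx : ((s i).modulus : ℚ) * x = α + (s i).residue * β := by
      have := congrArg (fun v : limit s => v.1.1) h
      simpa [x, hα, hβ] using this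
    have hy : ((s i).modulus : ℚ) * y = γ + (s i).residue * δ := by
      have := congrArg (fun v : limit s => v.1.2) h
      simpa [y, hγ, hδ] using this
    obtain ⟨t, ht⟩ := (hs.mono hij).2
    have ht' : ((s j).residue : ℚ) = (s i).residue + (s i).modulus * t := by
      have : (s j).residue = (s i).residue + (s i).modulus * t := by rw [← ht]; ring
      rw [this]; push_cast; ring
    refine ⟨D * l + t * (a + (s i).residue * b), ?_⟩
    have : ((c + (d - a) * (s i).residue + -b * (s i).residue ^ 2 : ℤ) : ℚ) =
        (((s i).modulus * (D * l + t * (a + (s i).residue * b)) : ℤ) : ℚ) := by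
      push_cast
      rw [← hl, ht', ← ha, ← hb, ← hc, ← hd]
      linear_combination -(D : ℚ) * hy +
        (D * ((s i).residue + (s i).modulus * t) : ℚ) * hx
    exact_mod_cast this
  have hDq : (D : ℚ) ≠ 0 := by exact_mod_cast hD
  obtain ⟨h1, h2, h3⟩ := key
  have hb0 : b = 0 := by omega
  have had : a = d := by omega
  refine ⟨?_, ?_, ?_⟩
  · rw [hb0, Int.cast_zero, mul_eq_zero] at hb
    exact hb.resolve_left hDq
  · rw [h1, Int.cast_zero, mul_eq_zero] at hc
    exact hc.resolve_left hDq
  · rw [had, ← hd] at ha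
    exact mul_left_cancel₀ hDq ha

theorem IsGeneric.exists_zsmul (hs : IsGeneric s) (f : limit s →+ limit s) :
    ∃ k : ℤ, ∀ w, f w = k • w := by
  obtain ⟨h1, h2, h3⟩ := hs.scalar f
  obtain ⟨k, hk⟩ := mem_int_of_fst_eq_zero hs.mono (f (vert hs.mono)).2 h1
  refine ⟨k, fun w => ?_⟩
  have : f - zsmulAddGroupHom k = 0 := by
    refine hom_eq_zero hs.mono _ ?_ ?_
    · rw [AddMonoidHom.sub_apply, sub_eq_zero]
      refine Subtype.ext (Prod.ext ?_ ?_)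
      · rw [h3, hk]; simp [horiz]
      · rw [h2]; simp [horiz]
    · rw [AddMonoidHom.sub_apply, sub_eq_zero]
      refine Subtype.ext (Prod.ext ?_ ?_)
      · rw [h1]; simp [vert]
      · rw [hk]; simp [vert]
  have hw := DFunLike.congr_fun this w
  rwa [AddMonoidHom.sub_apply, AddMonoidHom.zero_apply, sub_eq_zero] at hw

theorem IsGeneric.end_equiv_int (hs : IsGeneric s) :
    Nonempty (AddMonoid.End (limit s) ≃+* ℤ) := by
  have hcast : ∀ (k : ℤ) (w : limit s), Int.castRingHom (AddMonoid.End (limit s)) k w = k • w :=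
    fun k w => by simp
  refine ⟨(RingEquiv.ofBijective (Int.castRingHom (AddMonoid.End (limit s))) ⟨?_, ?_⟩).symm⟩
  · rw [injective_iff_map_eq_zero]
    intro k hk
    have h := hcast k (vert hs.mono)
    rw [hk] at h
    have := congrArg (fun v : limit s => v.1.2) h
    simpa [vert] using this.symm
  · intro f
    obtain ⟨k, hk⟩ := hs.exists_zsmul f
    exact ⟨k, AddMonoidHom.ext fun w => (hcast k w).trans (hk w).symm⟩

/-- If w = (x, y) is divisible by every modulus, so is y - ax, which after clearing denominators is
a linear relation for a. -/
theorem IsGeneric.hausdorff (hs : IsGeneric s) (w : limit s)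
    (hw : ∀ n : ℕ, 0 < n → ∃ v : limit s, n • v = w) : w = 0 := by
  obtain ⟨D, hD, a, b, ha, hb⟩ : ∃ D : ℕ, D ≠ 0 ∧ ∃ a b : ℤ, D * w.1.1 = a ∧ D * w.1.2 = b := by
    refine ⟨w.1.1.den * w.1.2.den, mul_ne_zero w.1.1.den_nz w.1.2.den_nz,
      w.1.1.num * w.1.2.den, w.1.2.num * w.1.1.den, ?_, ?_⟩ <;> push_cast
    · linear_combination (w.1.2.den : ℚ) * Rat.mul_den_eq_num w.1.1
    · linear_combination (w.1.1.den : ℚ) * Rat.mul_den_eq_num w.1.2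
  have hDq : (D : ℚ) ≠ 0 := by exact_mod_cast hD
  obtain ⟨h1, h2, -⟩ := hs.quadratic b (-a) 0 fun i => by
    obtain ⟨v, hv⟩ := hw _ (s i).pos
    obtain ⟨j, hij, -, l, hl⟩ := exists_le_mem hs.mono v.2 i
    have hx : ((s i).modulus : ℚ) * v.1.1 = w.1.1 := by rw [← hv]; simp
    have hy : ((s i).modulus : ℚ) * v.1.2 = w.1.2 := by rw [← hv]; simp
    obtain ⟨t, ht⟩ := (hs.mono hij).2
    have ht' : ((s j).residue : ℚ) = (s i).residue + (s i).modulus * t := by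
      have : (s j).residue = (s i).residue + (s i).modulus * t := by rw [← ht]; ring
      rw [this]; push_cast; ring
    refine ⟨D * l + t * a, ?_⟩
    have : ((b + -a * (s i).residue + 0 * (s i).residue ^ 2 : ℤ) : ℚ) =
        (((s i).modulus * (D * l + t * a) : ℤ) : ℚ) := by
      push_cast
      rw [← hl, ht', ← ha, ← hb]
      linear_combination -(D : ℚ) * hy + (D * ((s i).residue + (s i).modulus * t) : ℚ) * hx
    exact_mod_cast this
  have ha0 : a = 0 := by omega
  refine Subtype.ext (Prod.ext ?_ ?_)
  · rw [ha0, Int.cast_zero, mul_eq_zero] at ha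
    exact ha.resolve_left hDq
  · rw [h1, Int.cast_zero, mul_eq_zero] at hb
    exact hb.resolve_left hDq

theorem IsGeneric.isTame (hs : IsGeneric s) : IsTame (limit s) where
  countable := inferInstance
  countable_hom := by
    refine Function.Injective.countable
      (f := fun f : limit s →+ ℚ => (f (horiz hs.mono), f (vert hs.mono))) fun f g h => ?_
    rw [← sub_eq_zero]
    obtain ⟨h1, h2⟩ := Prod.ext_iff.1 h
    exact hom_eq_zero hs.mono _ (sub_eq_zero.2 h1) (sub_eq_zero.2 h2)
  hausdorff := hs.hausdorff
  hom_int := hs.hom_int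

/-- A multiple k of `vert` that is divisible by n has its n-th part in ℤ · `vert`, so n divides k
and reduction modulo n extends to the whole group. -/
theorem IsGeneric.exists_hom_zmod (hs : IsGeneric s) {n : ℕ} (hn : 0 < n) :
    ∃ f : limit s →+ ZMod n, f (vert hs.mono) = 1 := by
  obtain ⟨f, hf⟩ := exists_extension_zmod (zmultiplesHom (limit s) (vert hs.mono)) hn
    (Int.castAddHom (ZMod n)) fun k c hkc => by
      have h1 : (0 : ℚ) = n * c.1.1 := by
        simpa [vert] using congrArg (fun v : limit s => v.1.1) hkc
      have h2 : (k : ℚ) = n * c.1.2 := by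
        simpa [vert] using congrArg (fun v : limit s => v.1.2) hkc
      have hn' : (n : ℚ) ≠ 0 := by exact_mod_cast hn.ne'
      obtain ⟨l, hl⟩ := mem_int_of_fst_eq_zero hs.mono c.2
        ((mul_eq_zero.1 h1.symm).resolve_left hn')
      rw [hl] at h2
      exact (ZMod.intCast_zmod_eq_zero_iff_dvd k n).2 ⟨l, by exact_mod_cast h2⟩
  exact ⟨f, by simpa using hf 1⟩

end Limit

/-! ### Conditions that can be met by refining a residue class -/

/-- The residue class of `a + nt` modulo `nM`. -/
def refinement (p : ResidueApprox) (M : ℕ) (hM : 0 < M) (t : ℤ) : ResidueApprox :=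
  ⟨p.modulus * M, Nat.mul_pos p.pos hM, p.residue + p.modulus * t⟩

theorem le_refinement (p : ResidueApprox) (M : ℕ) (hM : 0 < M) (t : ℤ) :
    p ≤ p.refinement M hM t :=
  ⟨⟨M, rfl⟩, t, by simp [refinement]⟩

theorem isCofinal_dvd {N : ℕ} (hN : 0 < N) : IsCofinal {p : ResidueApprox | N ∣ p.modulus} :=
  fun p => ⟨_, ⟨p.modulus, mul_comm _ _⟩, p.le_refinement N hN 0⟩

theorem exists_quadratic_ne_zero {a b c : ℤ} (h : ¬(a = 0 ∧ b = 0 ∧ c = 0)) (x : ℤ) {n : ℤ}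
    (hn : n ≠ 0) : ∃ t : ℤ, a + b * (x + n * t) + c * (x + n * t) ^ 2 ≠ 0 := by
  by_contra! H
  have h0 := H 0
  have h1 := H 1
  have h2 := H (-1)
  have hc : c * (2 * n ^ 2) = 0 := by linear_combination h1 + h2 - 2 * h0
  have hc0 : c = 0 := (mul_eq_zero.1 hc).resolve_right (by positivity)
  subst hc0
  have hb : b * n = 0 := by linear_combination h1 - h0
  have hb0 : b = 0 := (mul_eq_zero.1 hb).resolve_right hn
  subst hb0
  exact h ⟨by linear_combination h0, rfl, rfl⟩

/-- Move the residue to a point where the polynomial has a value v ≠ 0; a modulus divisible by |v| +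
1 cannot divide v. -/
theorem isCofinal_quadratic {a b c : ℤ} (h : ¬(a = 0 ∧ b = 0 ∧ c = 0)) :
    IsCofinal {p : ResidueApprox |
      ¬ (p.modulus : ℤ) ∣ a + b * p.residue + c * p.residue ^ 2} := by
  intro p
  obtain ⟨t, ht⟩ := exists_quadratic_ne_zero h p.residue
    (n := p.modulus) (by exact_mod_cast p.pos.ne')
  set v := a + b * (p.residue + p.modulus * t) + c * (p.residue + p.modulus * t) ^ 2 with hv
  refine ⟨p.refinement (v.natAbs + 1) (Nat.succ_pos _) t, ?_, le_refinement _ _ _ _⟩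
  intro hdvd
  have h1 : ((v.natAbs + 1 : ℕ) : ℤ) ∣ v := by
    refine Dvd.dvd.trans ?_ hdvd
    simp only [refinement]
    exact ⟨p.modulus, by push_cast; ring⟩
  have h2 := Nat.le_of_dvd (Int.natAbs_pos.2 ht) (Int.natCast_dvd.1 h1)
  omega

section Tame

variable {A : Type u} [AddCommGroup A]

/-- Choose m such that m does not divide n • h, where n is the modulus. Of the refinements r and r +
n modulo nm at least one works, since otherwise subtraction would put n • h in nmA. Such a class
forbids a map out of the limit with `horiz` ↦ g and `vert` ↦ h. -/
theorem isCofinal_not_nsmul (hA : IsTame A) (g h : A) (hh : ∀ m : ℕ, 0 < m → m • h ≠ 0) :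
    IsCofinal {p : ResidueApprox | ¬∃ y : A, p.modulus • y = g + p.residue • h} := by
  intro p
  obtain ⟨m, hm, hy⟩ : ∃ m : ℕ, 0 < m ∧ ∀ y : A, m • y ≠ p.modulus • h := by
    by_contra! H
    exact hh _ p.pos (hA.hausdorff _ H)
  by_cases h0 : ∃ y : A, (p.modulus * m) • y = g + p.residue • h
  · refine ⟨p.refinement m hm 1, ?_, le_refinement _ _ _ _⟩
    rintro ⟨z, hz⟩
    obtain ⟨y, hy0⟩ := h0
    refine hy (p.modulus • (z - y)) ?_
    rw [← mul_smul, mul_comm, smul_sub, hy0]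
    have hz' : (p.modulus * m) • z = g + (p.residue + p.modulus * 1) • h := hz
    rw [hz', mul_one, add_smul, natCast_zsmul]
    abel
  · refine ⟨p.refinement m hm 0, ?_, le_refinement _ _ _ _⟩
    rintro ⟨z, hz⟩
    refine h0 ⟨z, ?_⟩
    have hz' : (p.modulus * m) • z = g + (p.residue + p.modulus * 0) • h := hz
    rw [hz', mul_zero, add_zero]

/-- A homomorphism to `ℚ` whose values have bounded denominators vanishes. -/
theorem hom_rat_eq_zero (hA : IsTame A) (f : A →+ ℚ) {n : ℕ} (hn : 0 < n)
    (h : ∀ x, ∃ k : ℤ, n * f x = k) : f = 0 := by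
  choose k hk using h
  have hk0 : AddMonoidHom.mk' k (fun x y => by
      have : ((k (x + y) : ℤ) : ℚ) = ((k x + k y : ℤ) : ℚ) := by
        push_cast; rw [← hk, ← hk, ← hk, map_add]; ring
      exact_mod_cast this) = 0 := hA.hom_int _
  ext x
  have hx : k x = 0 := DFunLike.congr_fun hk0 x
  have := hk x
  rw [hx, Int.cast_zero, mul_eq_zero] at this
  exact this.resolve_left (by exact_mod_cast hn.ne')

/-- Such a class forbids f and g as the coordinates of a map from A to the limit. If no refinement
worked, comparing two residues would make n f integral, n being the modulus, so f = 0; then g is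
integral and also zero. -/
theorem isCofinal_hom (hA : IsTame A) (f g : A →+ ℚ) (hfg : ¬(f = 0 ∧ g = 0)) :
    IsCofinal {p : ResidueApprox | ∃ x : A, (∃ k : ℤ, p.modulus * f x = k) ∧
      ∀ l : ℤ, g x - p.residue * f x ≠ l} := by
  intro p
  by_contra! H
  have key : ∀ (x : A) (t : ℤ), ∃ l : ℤ, g x - (p.residue + p.modulus * t) * f x = l := by
    intro x t
    by_contra! hx
    refine H (p.refinement (f x).den (Rat.pos _) t)
      ⟨x, ⟨p.modulus * (f x).num, ?_⟩, fun l hl => hx l ?_⟩ (le_refinement _ _ _ _)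
    · simp only [refinement]
      push_cast
      linear_combination (p.modulus : ℚ) * Rat.mul_den_eq_num (f x)
    · rw [← hl]
      simp [refinement]
  have hf : f = 0 := hom_rat_eq_zero hA f p.pos fun x => by
    obtain ⟨l, hl⟩ := key x 0
    obtain ⟨l', hl'⟩ := key x 1
    refine ⟨l - l', ?_⟩
    push_cast at hl hl' ⊢
    rw [← hl, ← hl']
    ring
  refine hfg ⟨hf, hom_rat_eq_zero hA g one_pos fun x => ?_⟩
  obtain ⟨l, hl⟩ := key x 0
  exact ⟨l, by rw [← hl, hf]; simp⟩

/-- Countably many dense conditions guarantee that there are no homomorphisms from `A` to the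
limit and only torsion homomorphisms back. -/
theorem exists_conditions (hA : IsTame A) :
    ∃ 𝒟 : Set (Order.Cofinal ResidueApprox), 𝒟.Countable ∧
      ∀ s, IsGeneric s → (∀ D ∈ 𝒟, ∃ i, s i ∈ D) →
        (∀ f : A →+ limit s, f = 0) ∧ ∀ f : limit s →+ A, ∃ m : ℕ, 0 < m ∧ m • f = 0 := by
  have := hA.countable
  have := hA.countable_hom
  let 𝒟₁ : {q : A × A // ∀ m : ℕ, 0 < m → m • q.2 ≠ 0} → Order.Cofinal ResidueApprox :=
    fun q => ⟨_, isCofinal_not_nsmul hA q.1.1 q.1.2 q.2⟩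
  let 𝒟₂ : {q : (A →+ ℚ) × (A →+ ℚ) // ¬(q.1 = 0 ∧ q.2 = 0)} → Order.Cofinal ResidueApprox :=
    fun q => ⟨_, isCofinal_hom hA q.1.1 q.1.2 q.2⟩
  refine ⟨Set.range 𝒟₁ ∪ Set.range 𝒟₂, (Set.countable_range _).union (Set.countable_range _),
    fun s hs hD => ⟨fun f => ?_, fun f => ?_⟩⟩
  · let g₁ : A →+ ℚ := (AddMonoidHom.fst ℚ ℚ).comp ((limit s).subtype.comp f)
    let g₂ : A →+ ℚ := (AddMonoidHom.snd ℚ ℚ).comp ((limit s).subtype.comp f)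
    by_contra hf
    have hg : ¬(g₁ = 0 ∧ g₂ = 0) := by
      rintro ⟨h1, h2⟩
      refine hf (AddMonoidHom.ext fun x => Subtype.ext (Prod.ext ?_ ?_))
      · exact DFunLike.congr_fun h1 x
      · exact DFunLike.congr_fun h2 x
    obtain ⟨i, x, ⟨k, hk⟩, hx⟩ := hD _ (Or.inr ⟨⟨(g₁, g₂), hg⟩, rfl⟩)
    obtain ⟨j, hij, -, l, hl⟩ := exists_le_mem hs.mono (f x).2 i
    obtain ⟨t, ht⟩ := (hs.mono hij).2
    refine hx (l + t * k) ?_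
    have ht' : ((s j).residue : ℚ) = (s i).residue + (s i).modulus * t := by
      have : (s j).residue = (s i).residue + (s i).modulus * t := by rw [← ht]; ring
      rw [this]; push_cast; ring
    push_cast
    rw [← hl, ← hk, ht']
    simp only [g₁, g₂, AddMonoidHom.comp_apply, AddSubgroup.coe_subtype, AddMonoidHom.coe_fst,
      AddMonoidHom.coe_snd]
    ring
  · have htors : ∃ m : ℕ, 0 < m ∧ m • f (vert hs.mono) = 0 := by
      by_contra! h
      obtain ⟨i, hi⟩ := hD _ (Or.inl ⟨⟨(f (horiz hs.mono), f (vert hs.mono)), h⟩, rfl⟩)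
      exact hi ⟨_, map_nsmul_frac hs.mono f i⟩
    obtain ⟨m, hm, hmf⟩ := htors
    -- The map m • f kills `vert`, modulo which the limit is divisible; its values are thus
    -- divisible by every n.
    refine ⟨m, hm, AddMonoidHom.ext fun w => hA.hausdorff _ fun n hn => ?_⟩
    obtain ⟨v, l, rfl⟩ := exists_nsmul_sub hs hn w
    refine ⟨m • f v, ?_⟩
    rw [AddMonoidHom.smul_apply, map_add, map_nsmul, map_zsmul, smul_add, smul_comm m l, hmf,
      smul_zero, add_zero, smul_comm]

end Tame

/-! ### Generic sequences and orthogonal families -/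

theorem exists_isGeneric {𝒟 : Set (Order.Cofinal ResidueApprox)} (h𝒟 : 𝒟.Countable) :
    ∃ s, IsGeneric s ∧ ∀ D ∈ 𝒟, ∃ i, s i ∈ D := by
  let 𝒟₁ : {N : ℕ // 0 < N} → Order.Cofinal ResidueApprox := fun N => ⟨_, isCofinal_dvd N.2⟩
  let 𝒟₂ : {q : ℤ × ℤ × ℤ // ¬(q.1 = 0 ∧ q.2.1 = 0 ∧ q.2.2 = 0)} → Order.Cofinal ResidueApprox :=
    fun q => ⟨_, isCofinal_quadratic q.2⟩
  let 𝒞 := 𝒟 ∪ (Set.range 𝒟₁ ∪ Set.range 𝒟₂)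
  have h𝒞 : 𝒞.Countable := h𝒟.union ((Set.countable_range _).union (Set.countable_range _))
  have : Encodable 𝒞 := h𝒞.toEncodable
  let s := Order.sequenceOfCofinals (⟨1, one_pos, 0⟩ : ResidueApprox) (fun D : 𝒞 => D.1)
  have hs : ∀ D ∈ 𝒞, ∃ i, s i ∈ D := fun D hD =>
    ⟨_, Order.sequenceOfCofinals.encode_mem _ (fun D : 𝒞 => D.1) ⟨D, hD⟩⟩
  refine ⟨s, ⟨Order.sequenceOfCofinals.monotone _ _, fun N hN => ?_, fun a b c h => ?_⟩,
    fun D hD => hs D (Or.inl hD)⟩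
  · exact hs _ (Or.inr (Or.inl ⟨⟨N, hN⟩, rfl⟩))
  · by_contra hne
    obtain ⟨i, hi⟩ := hs _ (Or.inr (Or.inr ⟨⟨(a, b, c), hne⟩, rfl⟩))
    exact hi (h i)

/-- For every tame group there are infinitely many pairwise orthogonal generic limits. -/
theorem exists_orthogonal_family {A : Type u} [AddCommGroup A] (hA : IsTame A) :
    ∃ s : ℕ → ℕ → ResidueApprox, (∀ i, IsGeneric (s i)) ∧
      (∀ i, ∀ f : A →+ limit (s i), f = 0) ∧
      (∀ i, ∀ f : limit (s i) →+ A, ∃ m : ℕ, 0 < m ∧ m • f = 0) ∧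
      ∀ i j, i ≠ j → ∀ f : limit (s i) →+ limit (s j), f = 0 := by
  obtain ⟨𝒟₀, hc₀, h₀⟩ := exists_conditions hA
  obtain ⟨s, hs, horth⟩ := exists_seq_of_forall_finset_exists
    (fun s : ℕ → ResidueApprox => IsGeneric s ∧ (∀ f : A →+ limit s, f = 0) ∧
      ∀ f : limit s →+ A, ∃ m : ℕ, 0 < m ∧ m • f = 0)
    (fun s t => (∀ f : limit s →+ limit t, f = 0) ∧ ∀ f : limit t →+ limit s, f = 0) (by
      intro S hS
      -- The earlier limits are tame as well, so orthogonality to finitely many of them adds only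
      -- countably many conditions.
      have hcond := fun x : S => exists_conditions (hS x x.2).1.isTame
      choose 𝒟 hc h𝒟 using hcond
      obtain ⟨t, ht, htD⟩ := exists_isGeneric (hc₀.union (Set.countable_iUnion hc))
      refine ⟨t, ⟨ht, h₀ t ht fun D hD => htD D (Or.inl hD)⟩, fun x hx => ?_⟩
      obtain ⟨h1, h2⟩ := h𝒟 ⟨x, hx⟩ t ht fun D hD =>
        htD D (Or.inr (Set.mem_iUnion.2 ⟨⟨x, hx⟩, hD⟩))
      refine ⟨h1, fun f => ?_⟩
      obtain ⟨m, hm, hmf⟩ := h2 f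
      ext1 w
      have := DFunLike.congr_fun hmf w
      exact (nsmul_eq_zero_iff_right hm.ne').1 this)
  refine ⟨s, fun i => (hs i).1, fun i => (hs i).2.1, fun i => (hs i).2.2, fun i j hij => ?_⟩
  rcases lt_or_gt_of_ne hij with h | h
  · exact (horth i j h).1
  · exact (horth j i h).2

end ResidueApprox

/-! ### Rigid epimorphisms onto finite groups -/

/-- A group is not the union of two proper subgroups. -/
theorem eq_or_eq_neg_of_forall {L : Type*} [AddCommGroup L] (φ : L →+ L)
    (h : ∀ x, φ x = x ∨ φ x = -x) : (∀ x, φ x = x) ∨ ∀ x, φ x = -x := by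
  by_contra! ⟨⟨x, hx⟩, y, hy⟩
  have hx' := (h x).resolve_left hx
  have hy' := (h y).resolve_right hy
  rcases h (x + y) with hxy | hxy <;> rw [map_add, hx', hy'] at hxy
  · exact hx (hx'.trans (add_right_cancel hxy))
  · rw [neg_add] at hxy
    exact hy (hy'.trans (add_left_cancel hxy))

/-- Isomorphic groups have isomorphic endomorphism rings. -/
def endCongr {A B : Type*} [AddCommGroup A] [AddCommGroup B] (e : A ≃+ B) :
    AddMonoid.End A ≃+* AddMonoid.End B where
  toFun f := (e.toAddMonoidHom.comp f).comp e.symm.toAddMonoidHom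
  invFun f := (e.symm.toAddMonoidHom.comp f).comp e.toAddMonoidHom
  left_inv f := AddMonoidHom.ext fun x => by
    change e.symm (e (f (e.symm (e x)))) = f x
    rw [e.symm_apply_apply, e.symm_apply_apply]
  right_inv f := AddMonoidHom.ext fun x => by
    change e (e.symm (f (e (e.symm x)))) = f x
    rw [e.apply_symm_apply, e.apply_symm_apply]
  map_mul' f g := AddMonoidHom.ext fun x => by
    change e (f (g (e.symm x))) = e (f (e.symm (e (g (e.symm x)))))
    rw [e.symm_apply_apply]
  map_add' f g := AddMonoidHom.ext fun x => e.map_add (f (e.symm x)) (g (e.symm x))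

open ResidueApprox in
/-- For a tame group `A` and a finite group `L`, there is a torsion-free group with a rigid
epimorphism onto `L` that is orthogonal to `A` up to torsion. -/
theorem exists_rigid_epi {A L : Type u} [AddCommGroup A] [AddCommGroup L] (hA : IsTame A)
    [Finite L] {n : ℕ} (hn : 0 < n) (hL : ∀ x : L, n • x = 0) :
    ∃ (H : Type u) (_ : AddCommGroup H), IsAddTorsionFree H ∧ (∃ α : H →+ L, IsRigidEpi α) ∧
      (∀ f : A →+ H, f = 0) ∧ IsAddTorsion (H →+ A) ∧ IsOrthogonalRigidSum H := by
  classical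
  obtain ⟨s, hs, hto, hfrom, horth⟩ := exists_orthogonal_family hA
  obtain ⟨N, ⟨e⟩⟩ := Finite.exists_equiv_fin L
  -- One summand per element of L; `ULift` only adjusts the universe.
  let W : Fin N → Type u := fun i => ULift.{u} (limit (s i))
  let up : ∀ i : Fin N, limit (s i) →+ W i := fun i => AddEquiv.ulift.symm.toAddMonoidHom
  let down : ∀ i : Fin N, W i →+ limit (s i) := fun i => AddEquiv.ulift.toAddMonoidHom
  let H := DirectSum (Fin N) W
  let ι : ∀ i : Fin N, limit (s i) →+ H := fun i => (DirectSum.of W i).comp (up i)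
  let pr : ∀ i : Fin N, H →+ limit (s i) := fun i => (down i).comp (DFinsupp.evalAddMonoidHom i)
  have hprι : ∀ i w, pr i (ι i w) = w := fun i w => by
    change (down i) ((DirectSum.of W i (up i w)) i) = w
    rw [DirectSum.of_eq_same]
    rfl
  have hprι' : ∀ i j w, j ≠ i → pr j (ι i w) = 0 := fun i j w hij => by
    change (down j) ((DirectSum.of W i (up i w)) j) = 0
    rw [DirectSum.of_eq_of_ne _ _ _ hij, map_zero]
  have hext : ∀ x y : H, (∀ i, pr i x = pr i y) → x = y := fun x y h =>
    DFinsupp.ext fun i => ULift.ext _ _ (h i)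
  have hom_ext : ∀ {B : Type u} [AddCommGroup B] (f g : H →+ B),
      (∀ i w, f (ι i w) = g (ι i w)) → f = g := fun f g h =>
    DirectSum.addHom_ext fun i y => h i y.down
  have htf : ∀ i, IsAddTorsionFree (W i) := fun i =>
    Function.Injective.isAddTorsionFree (down i) ULift.down_injective
  -- Endomorphisms of H are diagonal: orthogonality kills the other entries, and each diagonal entry
  -- is an integer.
  have hrow : ∀ (g : H →+ H) (i : Fin N), ∃ k : ℤ, ∀ w, g (ι i w) = k • ι i w := by
    intro g i
    obtain ⟨k, hk⟩ := (hs i).exists_zsmul ((pr i).comp (g.comp (ι i)))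
    refine ⟨k, fun w => hext _ _ fun j => ?_⟩
    rw [map_zsmul]
    by_cases hij : j = i
    · subst hij
      rw [hprι]
      exact hk w
    · rw [hprι' _ _ _ hij, smul_zero]
      exact DFunLike.congr_fun (horth i j (fun h => hij (Fin.ext h.symm))
        ((pr j).comp (g.comp (ι i)))) w
  have hvert : ∀ (i : Fin N) (k : ℤ), k • ι i (vert (hs i).mono) = ι i (vert (hs i).mono) →
      k = 1 := by
    intro i k hk
    have h1 := congrArg (pr i) hk
    rw [map_zsmul, hprι] at h1
    have := congrArg (fun v : limit (s i) => v.1.2) h1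
    have h2 : (k : ℚ) = 1 := by simpa [vert] using this
    exact_mod_cast h2
  have hχ : ∀ i : Fin N, ∃ χ : limit (s i) →+ L, χ (vert (hs i).mono) = e.symm i := fun i => by
    obtain ⟨f, hf⟩ := (hs i).exists_hom_zmod hn
    let c : ZMod n →+ L := ZMod.lift n ⟨zmultiplesHom L (e.symm i), by simp [hL]⟩
    refine ⟨c.comp f, ?_⟩
    have : c ((1 : ℤ) : ZMod n) = e.symm i := (ZMod.lift_coe n _ 1).trans (one_zsmul _)
    rwa [Int.cast_one, ← hf] at this
  choose χ hχ using hχ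
  let α : H →+ L := DirectSum.toAddMonoid fun i => (χ i).comp (down i)
  have hα : ∀ i, α (ι i (vert (hs i).mono)) = e.symm i := fun i => by
    have : α (ι i (vert (hs i).mono)) = χ i (vert (hs i).mono) :=
      DirectSum.toAddMonoid_of _ _ _
    rw [this, hχ]
  refine ⟨H, inferInstance, ?_, ⟨α, ?_, ?_⟩, ?_, ?_, ?_⟩
  · exact ⟨fun m hm x y hxy => hext _ _ fun i =>
      nsmul_right_injective hm (by
        have := congrArg (pr i) hxy
        simpa only [map_nsmul] using this)⟩
  · intro l
    exact ⟨ι (e l) (vert (hs (e l)).mono), by rw [hα, e.symm_apply_apply]⟩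
  · intro ψ φ hψφ
    refine eq_or_eq_neg_of_forall φ.toAddMonoidHom fun l => ?_
    obtain ⟨k, hk⟩ := hrow ψ.toAddMonoidHom (e l)
    obtain ⟨k', hk'⟩ := hrow ψ.symm.toAddMonoidHom (e l)
    have hk : ∀ w, ψ (ι (e l) w) = k • ι (e l) w := hk
    have hk' : ∀ w, ψ.symm (ι (e l) w) = k' • ι (e l) w := hk'
    have hkk : k * k' = 1 := hvert (e l) _ (by
      rw [mul_smul, ← hk', ← map_zsmul, ← hk, AddEquiv.symm_apply_apply])
    have hl : α (ι (e l) (vert (hs (e l)).mono)) = l := by rw [hα, e.symm_apply_apply]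
    have hφ : φ l = k • l := by
      rw [← hl, ← hψφ, hk, map_zsmul]
    rcases Int.isUnit_iff.1 (IsUnit.of_mul_eq_one _ hkk) with h | h
    · left
      simpa [h] using hφ
    · right
      simpa [h] using hφ
  · intro f
    ext1 x
    refine hext _ _ fun i => ?_
    rw [AddMonoidHom.zero_apply, map_zero]
    exact DFunLike.congr_fun (hto i ((pr i).comp f)) x
  · intro f
    choose m hm hmf using fun i : Fin N => hfrom i (f.comp (ι i))
    refine isOfFinAddOrder_iff_nsmul_eq_zero.2 ⟨∏ i, m i, Finset.prod_pos fun i _ => hm i, ?_⟩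
    refine hom_ext _ _ fun i w => ?_
    obtain ⟨c, hc⟩ := Finset.dvd_prod_of_mem m (Finset.mem_univ i)
    have := DFunLike.congr_fun (hmf i) w
    simp only [AddMonoidHom.smul_apply, AddMonoidHom.comp_apply, AddMonoidHom.zero_apply] at this
    rw [AddMonoidHom.smul_apply, hc, mul_comm, mul_smul, this, smul_zero,
      AddMonoidHom.zero_apply]
  · refine ⟨Fin N, inferInstance, W, inferInstance, htf, fun i => ?_, fun i j hij f => ?_,
      ⟨AddEquiv.refl H⟩⟩
    · obtain ⟨ε⟩ := (hs i).end_equiv_int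
      exact ⟨(endCongr AddEquiv.ulift).trans ε⟩
    · have := horth i j (fun h => hij (Fin.ext h)) ((down j).comp (f.comp (up i)))
      ext1 w
      exact ULift.ext _ _ (DFunLike.congr_fun this w.down)

theorem exists_projection {A : Type u} [AddCommGroup A] {T C : AddSubgroup A}
    (h : IsCompl T C) : ∃ π : A →+ C, (∀ c : C, π c = c) ∧ (∀ t ∈ T, π t = 0) ∧
      ∀ x, x - π x ∈ T := by
  have h' : IsCompl (AddSubgroup.toIntSubmodule C) (AddSubgroup.toIntSubmodule T) :=
    (AddSubgroup.toIntSubmodule.isCompl_iff.1 h).symm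
  let π : A →+ C := (Submodule.projectionOnto _ _ h').toAddMonoidHom
  have h1 : ∀ c : C, π c = c := fun c => Submodule.projectionOnto_apply_left h' c
  have h2 : ∀ t ∈ T, π t = 0 := fun t ht => Submodule.projectionOnto_apply_right h' ⟨t, ht⟩
  refine ⟨π, h1, h2, fun x => ?_⟩
  have hx : x ∈ T ⊔ C := by rw [h.sup_eq_top]; trivial
  obtain ⟨t, ht, c, hc, rfl⟩ := AddSubgroup.mem_sup.1 hx
  rw [map_add, h2 t ht, zero_add, h1 ⟨c, hc⟩, add_sub_cancel_right]
  exact ht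

theorem nsmul_quotient_nMul {A : Type u} [AddCommGroup A] (n : ℕ) (x : A ⧸ nMul A n) :
    n • x = 0 := by
  obtain ⟨x, rfl⟩ := QuotientAddGroup.mk_surjective x
  rw [← QuotientAddGroup.mk_nsmul, QuotientAddGroup.eq_zero_iff]
  exact ⟨x, rfl⟩

theorem exists_fuchsWitness {G : Type u} [AddCommGroup G] (hqd : IsQuotientDivisible G)
    (hG : IsTame G) {n : ℕ} (hn : 0 < n) {C : AddSubgroup G}
    (hC : IsCompl (nComponent G n) C) :
    ∃ (H : Type u) (_ : AddCommGroup H), IsFuchsWitness G n C H ∧ IsOrthogonalRigidSum H := by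
  obtain ⟨F, hF, -, hdiv⟩ := hqd.exists_fg
  obtain ⟨π, hπ, -, -⟩ := exists_projection hC
  have hfin : Finite (G ⧸ nMul G n) := finite_quotient_nMul hF hn (hdiv n hn)
  have : Finite (C ⧸ nMul C n) := by
    let q : G ⧸ nMul G n →+ C ⧸ nMul C n := QuotientAddGroup.map _ _ π (by
      rintro _ ⟨y, rfl⟩
      exact ⟨π y, by simp⟩)
    refine Finite.of_surjective q fun c => ?_
    obtain ⟨c, rfl⟩ := QuotientAddGroup.mk_surjective c
    exact ⟨QuotientAddGroup.mk (c : G), congrArg QuotientAddGroup.mk (hπ c)⟩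
  obtain ⟨H, _, h1, h2, h3, h4, h5⟩ := exists_rigid_epi hG hn (nsmul_quotient_nMul (A := C) n)
  exact ⟨H, _, ⟨h1, h2, h3, h4⟩, h5⟩


/-! ### Pullbacks over C/nC and what their isomorphisms remember -/

section Pullback

variable {C H : Type u} [AddCommGroup C] [AddCommGroup H] {n : ℕ}

/-- The pullback of `α : H → C / nC` and of `b : C → C` followed by `C → C / nC`. -/
def pullback (n : ℕ) (α : H →+ C ⧸ nMul C n) (b : C →+ C) : AddSubgroup (C × H) where
  carrier := {x | (QuotientAddGroup.mk (b x.1) : C ⧸ nMul C n) = α x.2}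
  zero_mem' := by simp
  add_mem' {x y} hx hy := by
    change QuotientAddGroup.mk (b (x.1 + y.1)) = α (x.2 + y.2)
    rw [map_add, map_add, QuotientAddGroup.mk_add]
    exact congrArg₂ _ hx hy
  neg_mem' {x} hx := by
    change QuotientAddGroup.mk (b (-x.1)) = α (-x.2)
    rw [map_neg, map_neg, QuotientAddGroup.mk_neg]
    exact congrArg _ hx

theorem mem_pullback {α : H →+ C ⧸ nMul C n} {b : C →+ C} {x : C × H} :
    x ∈ pullback n α b ↔ (QuotientAddGroup.mk (b x.1) : C ⧸ nMul C n) = α x.2 := Iff.rfl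

theorem mk_eq_iff {x y : C} :
    (QuotientAddGroup.mk x : C ⧸ nMul C n) = QuotientAddGroup.mk y ↔ x - y ∈ nMul C n :=
  QuotientAddGroup.eq_iff_sub_mem

/-- Changing the pullback by an endomorphism invertible modulo `n` is not seen after adding `C`:
`diag(a⁻¹, a)` is a product of elementary matrices. -/
theorem nonempty_prod_pullback_equiv (α : H →+ C ⧸ nMul C n) (a a' : C →+ C)
    (h : ∀ c, a (a' c) - c ∈ nMul C n) :
    Nonempty ((C × pullback n α a) ≃+ (C × pullback n α (AddMonoidHom.id C))) := by
  have key : ∀ c₁ c₂ : C, (QuotientAddGroup.mk (c₁ + a c₂ + a (c₂ - a' (c₁ + a c₂))) :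
      C ⧸ nMul C n) = QuotientAddGroup.mk (a c₂) := fun c₁ c₂ => by
    rw [mk_eq_iff]
    have := neg_mem (h (c₁ + a c₂))
    convert this using 1
    rw [map_sub]
    abel
  -- Three shears of C × C, by a, -a' and a, followed by a swap; these are invertible for any a and
  -- a'. The congruence aa' ≡ 1 enters only through `key`, which keeps the H-coordinate compatible.
  refine ⟨{ toFun := fun x => (x.2.1.1 - a' (x.1 + a x.2.1.1),
              ⟨(x.1 + a x.2.1.1 + a (x.2.1.1 - a' (x.1 + a x.2.1.1)), x.2.1.2),
                mem_pullback.2 ((key _ _).trans x.2.2)⟩)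
            invFun := fun y => (y.2.1.1 - a y.1 - a (y.1 + a' (y.2.1.1 - a y.1)),
              ⟨(y.1 + a' (y.2.1.1 - a y.1), y.2.1.2), mem_pullback.2 ?_⟩)
            left_inv := fun x => ?_
            right_inv := fun y => ?_
            map_add' := fun x y => ?_ }⟩
  · refine Eq.trans ?_ (y.2.2 : (QuotientAddGroup.mk y.2.1.1 : C ⧸ nMul C n) = α y.2.1.2)
    rw [← key (y.2.1.1 - a y.1 - a (y.1 + a' (y.2.1.1 - a y.1)))]
    congr 1
    simp
  · refine Prod.ext ?_ (Subtype.ext (Prod.ext ?_ rfl)) <;> simp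
  · refine Prod.ext ?_ (Subtype.ext (Prod.ext ?_ rfl)) <;> simp
  · refine Prod.ext ?_ (Subtype.ext (Prod.ext ?_ rfl))
    · simp only [Prod.fst_add, Prod.snd_add, AddSubgroup.coe_add, map_add]
      abel
    · simp only [Prod.fst_add, Prod.snd_add, AddSubgroup.coe_add, map_add, map_sub]
      abel

/-- Without n-torsion, common factors of m and n can be cancelled from m • c = 0; once m is coprime
to n, Bézout exhibits c as a multiple of n. -/
theorem mem_nMul_of_torsion (hC : ∀ c : C, n • c = 0 → c = 0) (m : ℕ) :
    0 < m → ∀ c : C, m • c = 0 → c ∈ nMul C n := by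
  induction m using Nat.strong_induction_on with
  | _ m ih =>
    intro hm c hc
    by_cases hg : m.gcd n = 1
    · obtain ⟨u, v, huv⟩ := Nat.isCoprime_iff_coprime.2 hg
      refine ⟨v • c, ?_⟩
      have h1 : (u * m + v * n) • c = c := by rw [huv, one_smul]
      rw [add_smul, mul_smul, mul_smul, natCast_zsmul, natCast_zsmul, hc, smul_zero,
        zero_add] at h1
      rw [nsmulAddMonoidHom_apply, smul_comm, h1]
    · obtain ⟨k, hk⟩ := Nat.gcd_dvd_left m n
      obtain ⟨d, hd⟩ := Nat.gcd_dvd_right m n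
      have hg0 : 0 < m.gcd n := Nat.gcd_pos_of_pos_left n hm
      have hk0 : 0 < k := Nat.pos_of_ne_zero (by rintro rfl; omega)
      have hlt : k < m := by
        calc k < m.gcd n * k := by
              have : 1 < m.gcd n := by omega
              nlinarith
          _ = m := hk.symm
      refine ih k hlt hk0 c (hC _ ?_)
      rw [hd, mul_comm, mul_smul, ← mul_smul (m.gcd n), ← hk, hc, smul_zero]

/-- The embedding `c ↦ (nc, 0)` of `C` into a pullback. -/
def pullbackInl (α : H →+ C ⧸ nMul C n) (b : C →+ C) : C →+ pullback n α b where
  toFun c := ⟨(n • c, 0), mem_pullback.2 (by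
    rw [map_zero, QuotientAddGroup.eq_zero_iff, map_nsmul]
    exact ⟨b c, rfl⟩)⟩
  map_zero' := Subtype.ext (by simp)
  map_add' x y := Subtype.ext (by simp)

/-- The embedding `h ↦ (0, nh)` of `H` into a pullback. -/
def pullbackInr (α : H →+ C ⧸ nMul C n) (b : C →+ C) : H →+ pullback n α b where
  toFun h := ⟨(0, n • h), mem_pullback.2 (by
    rw [map_zero, map_nsmul, nsmul_quotient_nMul, QuotientAddGroup.mk_zero])⟩
  map_zero' := Subtype.ext (by simp)
  map_add' x y := Subtype.ext (by simp)

/-- A homomorphism between pullbacks is triangular when `Hom(C, H) = 0`. -/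
theorem exists_components {α : H →+ C ⧸ nMul C n} {b b' : C →+ C}
    (hC : ∀ c : C, n • c = 0 → c = 0) (hhom : ∀ f : C →+ H, f = 0)
    (hinj : ∀ c, b c ∈ nMul C n → c ∈ nMul C n) (hinj' : ∀ c, b' c ∈ nMul C n → c ∈ nMul C n)
    (hsurj : ∀ h, ∃ c, (c, h) ∈ pullback n α b) (θ : pullback n α b →+ pullback n α b') :
    ∃ (ψ : H →+ H) (u : C →+ C), (∀ x, (θ x).1.2 = ψ x.1.2) ∧
      ∀ c, θ (pullbackInl α b c) = pullbackInl α b' (u c) := by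
  have hzero : ∀ c, (θ (pullbackInl α b c)).1.2 = 0 := fun c =>
    DFunLike.congr_fun (hhom ((AddMonoidHom.snd C H).comp
      ((pullback n α b').subtype.comp (θ.comp (pullbackInl α b))))) c
  -- The kernel of the projection to H is the image of `pullbackInl`, as b c in nC forces c in nC.
  -- Since Hom(C, H) = 0, θ respects these kernels.
  have hdep : ∀ x, x.1.2 = 0 → (θ x).1.2 = 0 := by
    rintro ⟨⟨c, h⟩, hx⟩ hh
    obtain rfl : h = 0 := hh
    have hb : b c ∈ nMul C n := by
      rwa [mem_pullback, map_zero, QuotientAddGroup.eq_zero_iff] at hx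
    obtain ⟨d, hd⟩ := hinj c hb
    refine Eq.trans ?_ (hzero d)
    congr 3
    exact Subtype.ext (Prod.ext hd.symm rfl)
  choose r hr using hsurj
  have hψ : ∀ x, (θ x).1.2 = (θ ⟨(r x.1.2, x.1.2), hr x.1.2⟩).1.2 := fun x => by
    have := hdep (x - ⟨(r x.1.2, x.1.2), hr x.1.2⟩) (by simp)
    rwa [map_sub, AddSubgroup.coe_sub, Prod.snd_sub, sub_eq_zero] at this
  have hu : ∀ c, ∃ d, θ (pullbackInl α b c) = pullbackInl α b' d := fun c => by
    have h1 := (θ (pullbackInl α b c)).2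
    rw [mem_pullback, hzero, map_zero, QuotientAddGroup.eq_zero_iff] at h1
    obtain ⟨d, hd⟩ := hinj' _ h1
    exact ⟨d, Subtype.ext (Prod.ext hd.symm (hzero c))⟩
  choose u hu using hu
  have hinl : Function.Injective (pullbackInl α b') := by
    rw [injective_iff_map_eq_zero]
    intro c hc
    exact hC c (congrArg (fun x : pullback n α b' => x.1.1) hc)
  refine ⟨AddMonoidHom.mk' (fun h => (θ ⟨(r h, h), hr h⟩).1.2) fun h h' => ?_,
    AddMonoidHom.mk' u fun c d => hinl ?_, hψ, hu⟩
  · have := hψ (⟨(r h, h), hr h⟩ + ⟨(r h', h'), hr h'⟩)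
    rw [map_add] at this
    exact this.symm
  · rw [← hu, map_add, map_add, map_add, hu, hu]

/-- A rigid pullback remembers `a` up to automorphisms of `C`. -/
theorem exists_equiv_of_pullback_equiv {α : H →+ C ⧸ nMul C n} (hα : IsRigidEpi α) (hn : 0 < n)
    (hC : ∀ c : C, n • c = 0 → c = 0) (hhom : ∀ f : C →+ H, f = 0)
    (htors : ∀ f : H →+ C, ∃ m : ℕ, 0 < m ∧ m • f = 0) (a a' : C →+ C)
    (h : ∀ c, a (a' c) - c ∈ nMul C n) (h' : ∀ c, a' (a c) - c ∈ nMul C n)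
    (θ : pullback n α (AddMonoidHom.id C) ≃+ pullback n α a) :
    ∃ w : C ≃+ C, ∀ c, w c - a c ∈ nMul C n := by
  have hmul : ∀ (f : C →+ C) (c : C), c ∈ nMul C n → f c ∈ nMul C n := by
    rintro f _ ⟨d, rfl⟩
    exact ⟨f d, by simp⟩
  have hinja : ∀ c, a c ∈ nMul C n → c ∈ nMul C n := fun c hc => by
    have := sub_mem (hmul a' _ hc) (h' c)
    rwa [sub_sub_cancel] at this
  have hinj1 : ∀ c, AddMonoidHom.id C c ∈ nMul C n → c ∈ nMul C n := fun c hc => hc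
  have hsurj1 : ∀ x, ∃ c, (c, x) ∈ pullback n α (AddMonoidHom.id C) := fun x => by
    obtain ⟨c, hc⟩ := QuotientAddGroup.mk_surjective (α x)
    exact ⟨c, hc⟩
  have hsurja : ∀ x, ∃ c, (c, x) ∈ pullback n α a := fun x => by
    obtain ⟨c, hc⟩ := QuotientAddGroup.mk_surjective (α x)
    exact ⟨a' c, mem_pullback.2 ((mk_eq_iff.2 (h c)).trans hc)⟩
  obtain ⟨ψ, u, hψ, hu⟩ := exists_components hC hhom hinj1 hinja hsurj1 θ.toAddMonoidHom
  obtain ⟨ψ', u', hψ', hu'⟩ := exists_components hC hhom hinja hinj1 hsurja θ.symm.toAddMonoidHom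
  simp only [AddEquiv.coe_toAddMonoidHom] at hψ hu hψ' hu'
  have hinl : ∀ b : C →+ C, Function.Injective (pullbackInl α b) := fun b => by
    rw [injective_iff_map_eq_zero]
    exact fun c hc => hC c (congrArg (fun x : pullback n α b => x.1.1) hc)
  let ψe : H ≃+ H := AddEquiv.mk' ⟨ψ, ψ', fun x => by
      obtain ⟨c, hc⟩ := hsurj1 x
      rw [← hψ ⟨(c, x), hc⟩, ← hψ', AddEquiv.symm_apply_apply], fun x => by
      obtain ⟨c, hc⟩ := hsurja x
      rw [← hψ' ⟨(c, x), hc⟩, ← hψ, AddEquiv.apply_symm_apply]⟩ ψ.map_add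
  let ue : C ≃+ C := AddEquiv.mk' ⟨u, u', fun x => hinl (AddMonoidHom.id C) (by
      rw [← hu', ← hu, AddEquiv.symm_apply_apply]), fun x => hinl a (by
      rw [← hu, ← hu', AddEquiv.apply_symm_apply])⟩ u.map_add
  obtain ⟨m, hm, hmf⟩ := htors ((AddMonoidHom.fst C H).comp ((pullback n α a).subtype.comp
    (θ.toAddMonoidHom.comp (pullbackInr α (AddMonoidHom.id C)))))
  -- Multiplying by n splits x into its C- and H-parts. The H-part contributes only torsion to C, so
  -- the C-coordinate of θ x differs from u(x.1.1) by an element killed by mn, which lies in nC.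
  have key : ∀ x : pullback n α (AddMonoidHom.id C),
      (QuotientAddGroup.mk (a (u x.1.1)) : C ⧸ nMul C n) = α (ψ x.1.2) := by
    intro x
    rw [← hψ, ← (θ x).2]
    refine (mk_eq_iff.2 ?_).symm
    rw [← map_sub]
    refine hmul a _ (mem_nMul_of_torsion hC (m * n) (Nat.mul_pos hm hn) _ ?_)
    have hx : n • x = pullbackInl α _ x.1.1 + pullbackInr α _ x.1.2 :=
      Subtype.ext (Prod.ext (by simp [pullbackInl, pullbackInr])
        (by simp [pullbackInl, pullbackInr]))
    have h1 := congrArg θ hx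
    rw [map_nsmul, map_add, hu] at h1
    have h2 : n • (θ x).1.1 = n • u x.1.1 +
        (θ (pullbackInr α (AddMonoidHom.id C) x.1.2)).1.1 :=
      congrArg (fun y : pullback n α a => y.1.1) h1
    have h3 : m • (θ (pullbackInr α (AddMonoidHom.id C) x.1.2)).1.1 = 0 :=
      DFunLike.congr_fun hmf x.1.2
    rw [mul_smul, smul_sub, h2, add_sub_cancel_left, h3]
  let bar : (C →+ C) → (C ⧸ nMul C n →+ C ⧸ nMul C n) := fun f =>
    QuotientAddGroup.map _ _ f fun c hc => hmul f c hc
  have hbar : ∀ f c, bar f (QuotientAddGroup.mk c) = QuotientAddGroup.mk (f c) := fun f c => rfl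
  -- The automorphism au of C/nC lies under ψ; rigidity makes it ±1, so a is congruent to u⁻¹ or
  -- -u⁻¹.
  let φ : C ⧸ nMul C n ≃+ C ⧸ nMul C n := AddEquiv.mk'
    ⟨fun x => bar a (bar u x), fun x => bar u' (bar a' x), fun x => by
      obtain ⟨c, rfl⟩ := QuotientAddGroup.mk_surjective x
      simp only [hbar]
      rw [mk_eq_iff]
      have := hmul u' _ (h' (u c))
      rw [map_sub] at this
      rwa [show u' (u c) = c from ue.symm_apply_apply c] at this, fun x => by
      obtain ⟨c, rfl⟩ := QuotientAddGroup.mk_surjective x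
      simp only [hbar]
      rw [show u (u' (a' c)) = a' c from ue.apply_symm_apply (a' c), mk_eq_iff]
      exact h c⟩ fun x y => by simp
  have hφ : ∀ x, α (ψe x) = φ (α x) := fun x => by
    obtain ⟨c, hc⟩ := hsurj1 x
    have hc' : (QuotientAddGroup.mk c : C ⧸ nMul C n) = α x := hc
    rw [← hc']
    exact (key ⟨(c, x), hc⟩).symm
  rcases hα.2 ψe φ hφ with hp | hp
  · refine ⟨ue.symm, fun c => ?_⟩
    have h1 : (QuotientAddGroup.mk (a (u (u' c))) : C ⧸ nMul C n) = QuotientAddGroup.mk (u' c) :=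
      hp (QuotientAddGroup.mk (u' c))
    rw [show u (u' c) = c from ue.apply_symm_apply c] at h1
    exact mk_eq_iff.1 h1.symm
  · refine ⟨ue.symm.trans (AddEquiv.neg C), fun c => ?_⟩
    have h1 : (QuotientAddGroup.mk (a (u (u' c))) : C ⧸ nMul C n) =
        -QuotientAddGroup.mk (u' c) := hp (QuotientAddGroup.mk (u' c))
    rw [show u (u' c) = c from ue.apply_symm_apply c, ← QuotientAddGroup.mk_neg] at h1
    exact mk_eq_iff.1 h1.symm

end Pullback

/-! ### From cancellation to unit lifting -/

section UnitLifting

variable {G : Type u} [AddCommGroup G]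

theorem mem_torsion_iff {x : G} : x ∈ AddCommGroup.torsion G ↔ ∃ m : ℕ, 0 < m ∧ m • x = 0 :=
  isOfFinAddOrder_iff_nsmul_eq_zero

theorem map_mem_torsion {B : Type*} [AddCommGroup B] (f : G →+ B) {x : G}
    (hx : x ∈ AddCommGroup.torsion G) : f x ∈ AddCommGroup.torsion B := by
  obtain ⟨m, hm, h⟩ := mem_torsion_iff.1 hx
  exact mem_torsion_iff.2 ⟨m, hm, by rw [← map_nsmul, h, map_zero]⟩

theorem nonempty_equiv_prod {T C : AddSubgroup G} (h : IsCompl T C) :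
    Nonempty (G ≃+ (T × C)) := by
  obtain ⟨π, h1, h2, h3⟩ := exists_projection h
  exact ⟨{ toFun := fun x => (⟨x - π x, h3 x⟩, π x)
           invFun := fun y => y.1 + y.2
           left_inv := fun x => by simp
           right_inv := fun y => by
            refine Prod.ext (Subtype.ext ?_) ?_ <;> simp [h1, h2 y.1 y.1.2]
           map_add' := fun x y => by
            refine Prod.ext (Subtype.ext ?_) ?_
            · simp only [map_add, AddSubgroup.coe_add, Prod.fst_add]
              abel
            · simp }⟩

theorem mk_mk_eq_iff {n : ℕ} (x y : AddMonoid.End G) :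
    Ideal.Quotient.mk (natIdeal (WalkEnd G) n) (Ideal.Quotient.mk (homTorsion G) x) =
      Ideal.Quotient.mk (natIdeal (WalkEnd G) n) (Ideal.Quotient.mk (homTorsion G) y) ↔
    ∃ z : AddMonoid.End G, ∀ g, x g - y g - n • z g ∈ AddCommGroup.torsion G := by
  have hmem : ∀ z : AddMonoid.End G, (∀ g, x g - y g - n • z g ∈ AddCommGroup.torsion G) ↔
      x - y - n • z ∈ homTorsion G := fun _ => Iff.rfl
  simp only [hmem]
  rw [Ideal.Quotient.eq, natIdeal, Ideal.mem_span_singleton']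
  constructor
  · rintro ⟨r, hr⟩
    obtain ⟨z, rfl⟩ := Ideal.Quotient.mk_surjective r
    refine ⟨z, Ideal.Quotient.eq_zero_iff_mem.1 ?_⟩
    rw [map_sub, map_sub, map_nsmul, ← hr, nsmul_eq_mul, (Nat.cast_commute n _).eq, sub_self]
  · rintro ⟨z, hz⟩
    refine ⟨Ideal.Quotient.mk _ z, ?_⟩
    have := Ideal.Quotient.eq_zero_iff_mem.2 hz
    rw [map_sub, map_sub, map_nsmul, sub_eq_zero, nsmul_eq_mul] at this
    rw [this, (Nat.cast_commute n _).eq]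

/-- Cancellation of `G` lifts units of the Walk-endomorphism ring when every complement of
`T_n(G)` admits a group as in Fuchs' criterion. -/
theorem HasCancellation.hasUnitLifting (hcan : HasCancellation G)
    (hcompl : ∀ n : ℕ, 0 < n → ∃ C : AddSubgroup G, IsCompl (nComponent G n) C ∧
      ∃ (H : Type u) (_ : AddCommGroup H), IsFuchsWitness G n C H) :
    HasUnitLifting (WalkEnd G) := by
  intro n hn v
  obtain ⟨C, hTC, H, _, hH⟩ := hcompl n hn
  obtain ⟨α, hα⟩ := hH.exists_rigid
  obtain ⟨π, hπC, hπT, hπ⟩ := exists_projection hTC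
  have hT : ∀ x ∈ nComponent G n, x ∈ AddCommGroup.torsion G := fun x hx => by
    rw [nComponent_eq_pComponent hn] at hx
    obtain ⟨k, hk⟩ := hx
    exact mem_torsion_iff.2 ⟨n ^ k, pow_pos hn k, hk⟩
  have hCn : ∀ c : C, n • c = 0 → c = 0 := fun c hc => by
    have h1 : (c : G) ∈ nComponent G n := by
      rw [nComponent_eq_pComponent hn]
      exact ⟨1, by rw [pow_one]; exact congrArg Subtype.val hc⟩
    rw [← hπC c, hπT _ h1]
  have hCt : ∀ c : C, c ∈ AddCommGroup.torsion C → c ∈ nMul C n := fun c hc => by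
    obtain ⟨m, hm, h⟩ := mem_torsion_iff.1 hc
    exact mem_nMul_of_torsion hCn m hm c h
  obtain ⟨q, hq⟩ := Ideal.Quotient.mk_surjective (v : WalkEnd G ⧸ natIdeal (WalkEnd G) n)
  obtain ⟨q', hq'⟩ := Ideal.Quotient.mk_surjective (↑v⁻¹ : WalkEnd G ⧸ natIdeal (WalkEnd G) n)
  obtain ⟨x, rfl⟩ := Ideal.Quotient.mk_surjective q
  obtain ⟨x', rfl⟩ := Ideal.Quotient.mk_surjective q'
  let cut : AddMonoid.End G → (C →+ C) := fun f => π.comp (AddMonoidHom.comp f C.subtype)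
  have hcut : ∀ (f : AddMonoid.End G) (c : C), cut f c = π (f c) := fun _ _ => rfl
  -- Torsion of C lies in nC, so inverses modulo n and torsion on G become inverses modulo nC once
  -- compressed to C.
  have hinv : ∀ f f' : AddMonoid.End G, (∃ z : AddMonoid.End G, ∀ g,
      f (f' g) - g - n • z g ∈ AddCommGroup.torsion G) →
      ∀ c, cut f (cut f' c) - c ∈ nMul C n := by
    rintro f f' ⟨z, hz⟩ c
    have h1 : (f' c - π (f' c) : G) ∈ AddCommGroup.torsion G := hT _ (hπ _)
    have h1' : f (f' c - π (f' c) : G) ∈ AddCommGroup.torsion G :=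
      map_mem_torsion f h1
    rw [show f (f' c - π (f' c) : G) = f (f' c) - f (π (f' c)) from AddMonoidHom.map_sub f _ _]
      at h1'
    have h2 := hCt _ (map_mem_torsion π h1')
    have h3 := hCt _ (map_mem_torsion π (hz c))
    have h4 : n • π (z c) ∈ nMul C n := ⟨_, rfl⟩
    rw [map_sub] at h2
    rw [map_sub, map_sub, hπC, map_nsmul] at h3
    have := add_mem (sub_mem h3 h2) h4
    rw [hcut, hcut]
    convert this using 1
    abel
  let ρ : AddMonoid.End G →+* WalkEnd G ⧸ natIdeal (WalkEnd G) n :=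
    (Ideal.Quotient.mk (natIdeal (WalkEnd G) n)).comp (Ideal.Quotient.mk (homTorsion G))
  have hρ : ρ x = v := hq
  have hρ' : ρ x' = ↑v⁻¹ := hq'
  have hmul : ρ (x * x') = ρ 1 := by rw [ρ.map_mul, ρ.map_one, hρ, hρ', v.mul_inv]
  have hmul' : ρ (x' * x) = ρ 1 := by rw [ρ.map_mul, ρ.map_one, hρ, hρ', v.inv_mul]
  have ha := hinv x x' ((mk_mk_eq_iff _ _).1 hmul)
  have ha' := hinv x' x ((mk_mk_eq_iff _ _).1 hmul')
  obtain ⟨θ⟩ : Nonempty (pullback n α (AddMonoidHom.id C) ≃+ pullback n α (cut x)) := by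
    obtain ⟨e⟩ := nonempty_prod_pullback_equiv α (cut x) (cut x') ha
    obtain ⟨d⟩ := nonempty_equiv_prod hTC
    refine hcan _ _ ⟨?_⟩
    exact ((d.prodCongr (AddEquiv.refl _)).trans (AddEquiv.prodAssoc.trans
      (((AddEquiv.refl _).prodCongr e.symm).trans AddEquiv.prodAssoc.symm))).trans
      (d.symm.prodCongr (AddEquiv.refl _))
  obtain ⟨w, hw⟩ := exists_equiv_of_pullback_equiv hα hn hCn
    (fun f => by
      ext1 c
      have := DFunLike.congr_fun (hH.hom_zero (f.comp π)) (c : G)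
      rwa [AddMonoidHom.comp_apply, hπC] at this)
    (fun f => by
      obtain ⟨m, hm, h⟩ := isOfFinAddOrder_iff_nsmul_eq_zero.1
        (hH.hom_torsion (C.subtype.comp f))
      exact ⟨m, hm, AddMonoidHom.ext fun y => Subtype.ext (DFunLike.congr_fun h y)⟩)
    (cut x) (cut x') ha ha' θ
  -- The identity on the n-component, which is torsion and hence invisible in the Walk-endomorphism
  -- ring.
  let extend : (C →+ C) → AddMonoid.End G := fun f =>
    AddMonoidHom.mk' (fun g => g - π g + f (π g)) fun g g' => by
      simp only [map_add, AddSubgroup.coe_add]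
      abel
  have hextend : ∀ f g, extend f g = g - π g + f (π g) := fun _ _ => rfl
  have hcomp : ∀ f f' : C →+ C, (∀ c, f (f' c) = c) → extend f * extend f' = 1 := by
    intro f f' hff
    refine AddMonoidHom.ext fun g => ?_
    change extend f (extend f' g) = g
    have h1 : π (extend f' g) = f' (π g) := by
      rw [hextend, map_add, map_sub, hπC, hπC, sub_self, zero_add]
    rw [hextend f, h1, hff, hextend]
    abel
  let W : (AddMonoid.End G)ˣ := ⟨extend w, extend w.symm, hcomp _ _ w.apply_symm_apply,
    hcomp _ _ w.symm_apply_apply⟩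
  refine ⟨Units.map (Ideal.Quotient.mk (homTorsion G)).toMonoidHom W, ?_⟩
  rw [← hq]
  refine (mk_mk_eq_iff _ _).2 ?_
  choose β hβ using hw
  have hβ' : ∀ c, n • β c = w c - cut x c := hβ
  -- Division by n is unique in C, so the chosen quotients add up.
  let βh : C →+ C := AddMonoidHom.mk' β fun c d => by
    rw [← sub_eq_zero]
    refine hCn _ ?_
    rw [smul_sub, smul_add, hβ', hβ', hβ', map_add, map_add]
    abel
  refine ⟨(C.subtype.comp (βh.comp π) : G →+ G), fun g => ?_⟩
  change (g - π g + w (π g)) - x g - n • ((β (π g) : C) : G) ∈ AddCommGroup.torsion G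
  have h1 : (g - π g : G) ∈ AddCommGroup.torsion G := hT _ (hπ g)
  have h2 := map_mem_torsion (x : G →+ G) h1
  have h3 : (x (π g) - π (x (π g)) : G) ∈ AddCommGroup.torsion G := hT _ (hπ _)
  have h4 := congrArg Subtype.val (hβ' (π g))
  rw [AddSubgroup.coe_nsmul, AddSubgroup.coe_sub, hcut] at h4
  rw [h4]
  have h5 : x (g - π g : G) = x g - x (π g) := map_sub (x : G →+ G) _ _
  have := sub_mem (sub_mem h1 h2) h3
  change (g - π g : G) - x (g - π g : G) - (x (π g) - π (x (π g)) : G) ∈ _ at this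
  rw [h5] at this
  convert this using 1
  abel

end UnitLifting

end MixedGroup

theorem proposition3p4 {G : Type u} [AddCommGroup G]
    (hqd : MixedGroup.IsQuotientDivisible G)
    (hred : MixedGroup.IsReducedGroup G)
    (hfree : MixedGroup.NoFreeSummand G) :
    (MixedGroup.IsSelfSmall G ∧ MixedGroup.FiniteTorsionFreeRank G ∧
      ∀ n : ℕ, 0 < n →
        (∃ C : AddSubgroup G, IsCompl (MixedGroup.nComponent G n) C) ∧
        ∀ C : AddSubgroup G, IsCompl (MixedGroup.nComponent G n) C →
          ∃ (H : Type u) (_ : AddCommGroup H),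
            MixedGroup.IsFuchsWitness G n C H ∧ MixedGroup.IsOrthogonalRigidSum H) ∧
    (MixedGroup.HasCancellation G → MixedGroup.HasUnitLifting (MixedGroup.WalkEnd G)) := by
  obtain ⟨F, hF, -, hdiv⟩ := hqd.exists_fg
  have hG := hqd.isTame hred hfree
  have hcompl : ∀ n : ℕ, 0 < n →
      ∃ C : AddSubgroup G, IsCompl (MixedGroup.nComponent G n) C := fun n hn => by
    rw [MixedGroup.nComponent_eq_pComponent hn]
    exact MixedGroup.exists_isCompl_pComponent
      (MixedGroup.finite_pComponent hred hn (MixedGroup.finite_quotient_nMul hF hn (hdiv n hn)))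
  refine ⟨⟨hred.isSelfSmall hF hdiv, hqd.finite_rank, fun n hn => ⟨hcompl n hn, fun C hC =>
    MixedGroup.exists_fuchsWitness hqd hG hn hC⟩⟩, fun hcan => hcan.hasUnitLifting
      fun n hn => ?_⟩
  obtain ⟨C, hC⟩ := hcompl n hn
  obtain ⟨H, i, hH, -⟩ := MixedGroup.exists_fuchsWitness hqd hG hn hC
  exact ⟨C, hC, H, i, hH⟩
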